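/- **Conventions.** Let $(M,g)$ be a smooth pseudo-Riemannian manifold of dimension $n\ge 2$, with Levi-Civita connection $\nabla^g$, Ricci tensor $\mathrm{Ric}^g$ and scalar curvature $\mathrm{Scal}^g$; for $n\ge3$ let $\mathsf P^g=\frac1{n-2}\big(\mathrm{Ric}^g-\frac{\mathrm{Scal}^g}{2(n-1)}g\big)$ be the Schouten tensor. Let $S$ be a smooth, totally symmetric, $g$-trace-free $(0,3)$-tensor field and $t$ a smooth function on $M$. Put $g(\hat S(X,Y),Z)=S(X,Y,Z)$, $S_X=\hat S(X,\cdot)$, $\mathscr S(X,Y)=\mathrm{tr}(S_XS_Y)$, $\mathfrak S(X,Y,Z,W)=g(S_XY,S_ZW)$, $S(\mathrm{grad}\,t)=S(\cdot,\cdot,\mathrm{grad}_g t)$, $|S|^2=S_{ijk}S^{ijk}$; write $\mathring B=B-\frac1n(\mathrm{tr}_gB)\,g$, and $\mathrm{div}_g$ for the trace of $\nabla^g$ over the derivative slot and the first slot. Tensor powers of $(0,k)$-tensors are evaluated in order, $\Pi_{\mathrm{Sym}^m}$ is symmetrisation, and for a $(0,4)$-tensor $\Phi$ let $\Pi_{\mathrm{Sym}^3_0}\Phi=\Pi_{\mathrm{Sym}^3}\Phi-\frac3{n+2}\Pi_{\mathrm{Sym}^3}(g\otimes\phi)$,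 $\phi(X,W)=\mathrm{tr}_g(\Pi_{\mathrm{Sym}^3}\Phi)(\cdot,\cdot,X,W)$, be the projection onto tensors that are totally symmetric and trace-free in the first three arguments (symmetrisation being in these arguments). **Abundant manifolds, $n\ge3$.** $(M,g,S,t)$ is *abundant* if $g$ is (locally) conformally flat and the following hold: $$(\nabla^g)^2t=3\mathsf P^g+\tfrac13\big(dt^2-\tfrac12|\mathrm{grad}\,t|^2g\big)+\tfrac1{3(n-2)}\Big(\mathscr S+\tfrac{(n-6)|S|^2}{2(n-1)(n+2)}g\Big),$$ $$(\nabla^g_WS)(X,Y,Z)=\tfrac13(\Pi_{\mathrm{Sym}^3_0}S_1)(X,Y,Z,W),$$ where $$S_1(X,Y,Z,W)=g(S_XS_YZ,W)+3S(X,Y,W)\,dt(Z)+S(X,Y,Z)\,dt(W)+\Big(\tfrac4{n-2}\mathscr S(Y,Z)-3S(Y,Z,\mathrm{grad}\,t)\Big)g(X,W);$$ and the totally trace-free (algebraic Weyl) part of $\mathfrak S$ vanishes. That is, with $$B_1(X,Y,Z,W)=\tfrac14\big(\mathfrak S(X,Z,Y,W)-\mathfrak S(X,W,Y,Z)-\mathfrak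 S(Y,Z,X,W)+\mathfrak S(Y,W,X,Z)\big),$$ $\mathscr B(X,Y)=\frac1{n-2}\mathrm{tr}_gB_1(\cdot,X,\cdot,Y)$ and $Q=\mathscr B-\frac{\mathrm{tr}_g\mathscr B}{2(n-1)}g$, one has $$B_1(X,Y,Z,W)=Q(X,Z)g(Y,W)+Q(Y,W)g(X,Z)-Q(X,W)g(Y,Z)-Q(Y,Z)g(X,W).$$ In this case put $$\tau=\tfrac2{3(n-2)}\mathring{\mathscr S}-\tfrac23\big[S(\mathrm{grad}\,t)+dt\otimes dt\big]_\circ+2\mathring{\mathsf P}^g .$$ **Abundant manifolds, $n=2$.** Put $\mathcal X=\mathrm{div}_g S+\frac23S(\mathrm{grad}\,t)$, $$\tau=\tfrac23(\nabla^g)^2t-\tfrac23S(\mathrm{grad}\,t)+\tfrac13\mathcal X-\tfrac89\big(dt\otimes dt-\tfrac12|dt|^2g\big)-\tfrac19|S|^2g-\tfrac12\mathrm{Scal}^g\,g ,$$ $\beta(X)=\mathrm{tr}_g S(X,\cdot,\hat{\mathcal X}(\cdot))$, $\eta(X)=\mathrm{tr}_gS(X,\cdot,\hat\tau(\cdot))$.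 $(M,g,S,t)$ is *abundant* if $\tau$ is symmetric and trace-free and $$(\nabla^g_WS)(X,Y,Z)=\Pi_{\mathrm{Sym}^3_0}\big[-\tfrac23S\otimes dt+2\,dt\otimes S+\mathcal X\otimes g\big](X,Y,Z,W),$$ $$(\nabla^g_Z\mathcal X)(X,Y)=\tfrac13|S|^2S(X,Y,Z)+\tfrac43\Pi_{\mathrm{Sym}^2}\big(\beta\otimes g(\cdot,Z)-\tfrac12\beta(Z)g\big)(X,Y)+\tfrac43\Pi_{\mathrm{Sym}^3}\big(\mathcal X\otimes dt-\tfrac12g\otimes\mathcal X(\mathrm{grad}\,t)\big)(X,Y,Z),$$ $$\mathrm{div}_g\tau=-\eta+\beta-\tfrac23\mathcal X(\mathrm{grad}\,t)-\tfrac49S(\mathrm{grad}\,t,\mathrm{grad}\,t)-\tfrac59|S|^2dt+\tfrac12d\,\mathrm{Scal}^g-\mathrm{Scal}^g\,dt .$$ **Hypersurfaces.** Let $f:M\to\mathbb R^{n+1}$ be a smooth immersion with a smooth transversal field $\xi$, and $\bar\nabla$ the flat connection of $\mathbb R^{n+1}$. Decompose $\bar\nabla_XY=\nabla_XY+G(X,Y)\xi$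 and $\bar\nabla_X\xi=-\hat A(X)+\Theta(X)\xi$. The pair $(f,\xi)$ is a *relative normalisation* if $G$ is non-degenerate and $\Theta=0$; its cubic is $C(X,Y,Z)=G(\nabla_XY-\nabla^G_XY,Z)$. It is *associated* to the abundant manifold $(M,g,S,t)$ if $$G=g,\qquad C(X,Y,Z)=\tfrac13\big[S(X,Y,Z)+dt(X)g(Y,Z)+dt(Y)g(X,Z)+dt(Z)g(X,Y)\big].$$ A relative normalisation is a *graph normalisation* if there is a smooth function $F:M\to\mathbb R$ with $\bar\nabla_XY=\nabla_XY+(\nabla^2F)(X,Y)\,\xi$ and $\bar\nabla_X\xi=0$, where $\nabla$ is the induced connection; it is an *affine graph normalisation* if it is affinely equivalent to a graph normalisation. **Theorem.** Let $(M,g,S,t)$ be an abundant manifold of dimension $n\ge2$ and let $(f,\xi)$ be a relative affine hypersurface normalisation associated to it. Then $(f,\xi)$ is an affine graph normalisation if and only if, * for $n\ge3$: $$\mathring{\mathsf P}^g=\tfrac18\tau\qquad\text{and}\qquad\mathrm{Scal}^g=\tfrac19\big(|S|^2-(n-1)(n+2)|\mathrm{grad}_g t|^2\big);$$ * for $n=2$: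 $$\mathrm{Scal}^g=\tfrac19\big(|S|^2-4|\mathrm{grad}_gt|^2\big)\qquad\text{and}\qquad\tau=\tfrac23\mathcal X-\tfrac89\big(S(\mathrm{grad}_gt)+dt\otimes dt-\tfrac12|\mathrm{grad}_gt|^2g\big).$$ -/

import Mathlib

open scoped Manifold ContDiff

noncomputable section

/-! ## Tensor calculus in a coordinate domain

Tensor fields on an open subset of `ℝⁿ` are given by their components, which are functions on `ℝⁿ`.
`S i j k x` is the component `S(∂ᵢ, ∂ⱼ, ∂ₖ)` at `x`. A connection is given by its coefficients
`Γ k i j`, where `∇_{∂ᵢ} ∂ⱼ = ∑ₖ Γ k i j ∂ₖ`. -/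

namespace Coord

/-- The coordinate space `ℝⁿ`. -/
abbrev Space (n : ℕ) : Type := EuclideanSpace ℝ (Fin n)

abbrev Tensor1 (n : ℕ) : Type := Fin n → Space n → ℝ
abbrev Tensor2 (n : ℕ) : Type := Fin n → Fin n → Space n → ℝ
abbrev Tensor3 (n : ℕ) : Type := Fin n → Fin n → Fin n → Space n → ℝ
abbrev Tensor4 (n : ℕ) : Type := Fin n → Fin n → Fin n → Fin n → Space n → ℝ

/-- The partial derivative `∂ᵢ`, for functions with values in a normed space. -/
def pd {n : ℕ} {V : Type*} [NormedAddCommGroup V] [NormedSpace ℝ V] (i : Fin n)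
    (f : Space n → V) : Space n → V :=
  fun x => fderiv ℝ f x (EuclideanSpace.single i (1 : ℝ))

/-- The differential of a function, `(dt)ᵢ = ∂ᵢ t`. -/
def differential {n : ℕ} (t : Space n → ℝ) : Tensor1 n := fun i => pd i t

/-! ### Metric contractions -/

/-- The components `gⁱʲ` of the inverse metric. -/
def inv {n : ℕ} (g : Tensor2 n) : Tensor2 n :=
  fun i j x => (Matrix.of fun a b => g a b x)⁻¹ i j

/-- The metric trace `tr_g B = gⁱʲ Bᵢⱼ`. -/
def trace {n : ℕ} (g B : Tensor2 n) : Space n → ℝ :=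
  fun x => ∑ i, ∑ j, inv g i j x * B i j x

/-- The trace-free part `B - (1/n) (tr_g B) g`. -/
def traceFree {n : ℕ} (g B : Tensor2 n) : Tensor2 n :=
  fun i j x => B i j x - 1 / (n : ℝ) * trace g B x * g i j x

/-- `⟨u, v⟩_g = gⁱʲ uᵢ vⱼ`. -/
def inner1 {n : ℕ} (g : Tensor2 n) (u v : Tensor1 n) : Space n → ℝ :=
  fun x => ∑ i, ∑ j, inv g i j x * u i x * v j x

/-- `|S|² = gⁱᵃ gʲᵇ gᵏᶜ Sᵢⱼₖ S_abc`. -/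
def normSq3 {n : ℕ} (g : Tensor2 n) (S : Tensor3 n) : Space n → ℝ :=
  fun x => ∑ i, ∑ j, ∑ k, ∑ a, ∑ b, ∑ c,
    inv g i a x * inv g j b x * inv g k c x * S i j k x * S a b c x

/-- `Ŝ k i j` is the `∂ₖ`-component of the vector `Ŝ(∂ᵢ, ∂ⱼ)`, where
`g(Ŝ(X, Y), Z) = S(X, Y, Z)`. -/
def hat {n : ℕ} (g : Tensor2 n) (S : Tensor3 n) : Tensor3 n :=
  fun k i j x => ∑ l, inv g k l x * S i j l x

/-- The tensor `(X, Y) ↦ S(X, Y, û)`, where `û` is the vector field dual to the 1-form `u`. -/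
def contract1 {n : ℕ} (g : Tensor2 n) (S : Tensor3 n) (u : Tensor1 n) : Tensor2 n :=
  fun i j x => ∑ k, ∑ l, inv g k l x * S i j k x * u l x

/-- The 1-form `X ↦ B(X, û)`. -/
def contract1' {n : ℕ} (g B : Tensor2 n) (u : Tensor1 n) : Tensor1 n :=
  fun i x => ∑ k, ∑ l, inv g k l x * B i k x * u l x

/-- The 1-form `X ↦ tr_g S(X, ·, B̂(·)) = gʲᵃ gᵏᵇ S(X, ∂ⱼ, ∂ₖ) B_ab`. -/
def contract2 {n : ℕ} (g : Tensor2 n) (S : Tensor3 n) (B : Tensor2 n) : Tensor1 n :=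
  fun i x => ∑ j, ∑ k, ∑ a, ∑ b, inv g j a x * inv g k b x * S i j k x * B a b x

/-- `(X, Y) ↦ tr (S_X ∘ S_Y)`, where `S_X = Ŝ(X, ·)`. -/
def trProd {n : ℕ} (g : Tensor2 n) (S : Tensor3 n) : Tensor2 n :=
  fun i j x => ∑ a, ∑ b, hat g S a i b x * hat g S b j a x

/-- The Kulkarni-Nomizu product. -/
def kulkarniNomizu {n : ℕ} (B₁ B₂ : Tensor2 n) : Tensor4 n :=
  fun i j k l x => B₁ i k x * B₂ j l x + B₁ j l x * B₂ i k x
    - B₁ i l x * B₂ j k x - B₁ j k x * B₂ i l x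

/-! ### Connections and curvature -/

/-- The Christoffel symbols of the Levi-Civita connection of `g`. -/
def christoffel {n : ℕ} (g : Tensor2 n) : Tensor3 n :=
  fun k i j x => 1 / 2 * ∑ l, inv g k l x *
    (pd i (g j l) x + pd j (g i l) x - pd l (g i j) x)

/-- `curvature Γ l i j k` is the `∂ₗ`-component of `R(∂ᵢ, ∂ⱼ)∂ₖ`, where
`R(X, Y)Z = ∇_X ∇_Y Z - ∇_Y ∇_X Z - ∇_[X,Y] Z`. -/
def curvature {n : ℕ} (Γ : Tensor3 n) : Tensor4 n :=
  fun l i j k x => pd i (Γ l j k) x - pd j (Γ l i k) x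
    + ∑ m, (Γ l i m x * Γ m j k x - Γ l j m x * Γ m i k x)

/-- `Ric(Y, Z) = tr (X ↦ R(X, Y)Z)`. -/
def ricci {n : ℕ} (Γ : Tensor3 n) : Tensor2 n :=
  fun j k x => ∑ i, curvature Γ i i j k x

/-- The scalar curvature of `g`. -/
def scal {n : ℕ} (g : Tensor2 n) : Space n → ℝ := trace g (ricci (christoffel g))

/-- The Schouten tensor `(1/(n-2)) (Ric - tr_g(Ric)/(2(n-1)) g)` of `g`. Only used for `n ≥ 3`. -/
def schouten {n : ℕ} (g : Tensor2 n) : Tensor2 n :=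
  fun i j x => 1 / ((n : ℝ) - 2) *
    (ricci (christoffel g) i j x - scal g x / (2 * ((n : ℝ) - 1)) * g i j x)

/-- The Hessian `(∇²t)ᵢⱼ = ∂ᵢ∂ⱼt - Γᵏᵢⱼ ∂ₖt` with respect to a connection. -/
def hessian {n : ℕ} (Γ : Tensor3 n) (t : Space n → ℝ) : Tensor2 n :=
  fun i j x => pd i (pd j t) x - ∑ k, Γ k i j x * pd k t x

/-- `covDeriv2 Γ B l i j = (∇_{∂ₗ} B)(∂ᵢ, ∂ⱼ)`. -/
def covDeriv2 {n : ℕ} (Γ : Tensor3 n) (B : Tensor2 n) : Tensor3 n :=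
  fun l i j x => pd l (B i j) x - ∑ m, (Γ m l i x * B m j x + Γ m l j x * B i m x)

/-- `covDeriv3 Γ S l i j k = (∇_{∂ₗ} S)(∂ᵢ, ∂ⱼ, ∂ₖ)`. -/
def covDeriv3 {n : ℕ} (Γ : Tensor3 n) (S : Tensor3 n) : Tensor4 n :=
  fun l i j k x => pd l (S i j k) x
    - ∑ m, (Γ m l i x * S m j k x + Γ m l j x * S i m k x + Γ m l k x * S i j m x)

/-- The divergence `(div_g B)(X) = gᵃᵇ (∇_a B)(∂_b, X)`. -/
def div2 {n : ℕ} (g B : Tensor2 n) : Tensor1 n :=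
  fun i x => ∑ a, ∑ b, inv g a b x * covDeriv2 (christoffel g) B a b i x

/-- The divergence `(div_g S)(X, Y) = gᵃᵇ (∇_a S)(∂_b, X, Y)`. -/
def div3 {n : ℕ} (g : Tensor2 n) (S : Tensor3 n) : Tensor2 n :=
  fun i j x => ∑ a, ∑ b, inv g a b x * covDeriv3 (christoffel g) S a b i j x

/-! ### Symmetrisations -/

/-- Symmetrisation of a `(0,2)`-tensor. -/
def sym2 {n : ℕ} (B : Tensor2 n) : Tensor2 n := fun i j x => 1 / 2 * (B i j x + B j i x)

/-- Symmetrisation of a `(0,3)`-tensor. -/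
def sym3 {n : ℕ} (S : Tensor3 n) : Tensor3 n :=
  fun i j k x => 1 / 6 *
    (S i j k x + S j k i x + S k i j x + S j i k x + S i k j x + S k j i x)

/-- Symmetrisation of a `(0,4)`-tensor in its first three arguments. -/
def symFirst3 {n : ℕ} (Φ : Tensor4 n) : Tensor4 n :=
  fun i j k l x => sym3 (fun a b c => Φ a b c l) i j k x

/-- The projection of a `(0,4)`-tensor `Φ` onto the tensors that are totally symmetric and
trace-free in the first three arguments,
`Sym³ Φ - 3/(n+2) Sym³(g ⊗ φ)` with `φ(X, W) = tr_g (Sym³ Φ)(·, ·, X, W)`. -/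
def symFirst3TraceFree {n : ℕ} (g : Tensor2 n) (Φ : Tensor4 n) : Tensor4 n :=
  fun i j k l x => symFirst3 Φ i j k l x - 3 / ((n : ℝ) + 2) *
    symFirst3 (fun a b c d y => g a b y * trace g (fun p q => symFirst3 Φ p q c d) y) i j k l x

/-! ### The structural equations of abundant manifolds, dimension at least three -/

/-- The tensor `S₁(X, Y, Z, W) = g(S_X S_Y Z, W) + 3 S(X, Y, W) dt(Z) + S(X, Y, Z) dt(W)
+ (4/(n-2) tr(S_Y S_Z) - 3 S(Y, Z, grad t)) g(X, W)`. -/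
def auxS {n : ℕ} (g : Tensor2 n) (S : Tensor3 n) (t : Space n → ℝ) : Tensor4 n :=
  fun i j k l x =>
    (∑ a, ∑ b, g b l x * hat g S b i a x * hat g S a j k x)
    + 3 * S i j l x * pd k t x + S i j k x * pd l t x
    + (4 / ((n : ℝ) - 2) * trProd g S j k x
        - 3 * contract1 g S (differential t) j k x) * g i l x

/-- The equation for the Hessian of `t`. -/
def HessianEq {n : ℕ} (g : Tensor2 n) (S : Tensor3 n) (t : Space n → ℝ) (x : Space n) : Prop :=
  ∀ i j, hessian (christoffel g) t i j x =
    3 * schouten g i j x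
    + 1 / 3 * (pd i t x * pd j t x
        - 1 / 2 * inner1 g (differential t) (differential t) x * g i j x)
    + 1 / (3 * ((n : ℝ) - 2)) * (trProd g S i j x
        + ((n : ℝ) - 6) * normSq3 g S x * g i j x / (2 * ((n : ℝ) - 1) * ((n : ℝ) + 2)))

/-- The equation `∇^g S = (1/3) Π S₁`; the last argument of `S₁` is the direction of the
derivative. -/
def DerivativeEq {n : ℕ} (g : Tensor2 n) (S : Tensor3 n) (t : Space n → ℝ) (x : Space n) : Prop :=
  ∀ i j k l, covDeriv3 (christoffel g) S l i j k x =
    1 / 3 * symFirst3TraceFree g (auxS g S t) i j k l x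

/-- The tensor `𝔖(X, Y, Z, W) = g(S_X Y, S_Z W)`. -/
def sqTensor {n : ℕ} (g : Tensor2 n) (S : Tensor3 n) : Tensor4 n :=
  fun i j k l x => ∑ a, ∑ b, g a b x * hat g S a i j x * hat g S b k l x

/-- The part `B₁` of `B` with the skew symmetries of a curvature tensor. -/
def curvPart {n : ℕ} (B : Tensor4 n) : Tensor4 n :=
  fun i j k l x => 1 / 4 * (B i k j l x - B i l j k x - B j k i l x + B j l i k x)

/-- `(X, Y) ↦ (1/(n-2)) tr_g B₁(·, X, ·, Y)`. -/
def curvTrace {n : ℕ} (g : Tensor2 n) (B : Tensor4 n) : Tensor2 n :=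
  fun i j x => 1 / ((n : ℝ) - 2) * trace g (fun a b => curvPart B a i b j) x

/-- The projection of `B` onto the totally trace-free (algebraic Weyl) tensors. -/
def weylPart {n : ℕ} (g : Tensor2 n) (B : Tensor4 n) : Tensor4 n :=
  fun i j k l x => curvPart B i j k l x -
    kulkarniNomizu (fun a b y => curvTrace g B a b y
      - trace g (curvTrace g B) y / (2 * ((n : ℝ) - 1)) * g a b y) g i j k l x

/-- The algebraic condition that the Weyl part of `𝔖` vanishes. -/
def WeylEq {n : ℕ} (g : Tensor2 n) (S : Tensor3 n) (x : Space n) : Prop :=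
  ∀ i j k l, weylPart g (sqTensor g S) i j k l x = 0

/-- The trace-free tensor `τ` of an abundant structure in dimension at least three. -/
def tau {n : ℕ} (g : Tensor2 n) (S : Tensor3 n) (t : Space n → ℝ) : Tensor2 n :=
  fun i j x => 2 / (3 * ((n : ℝ) - 2)) * traceFree g (trProd g S) i j x
    - 2 / 3 * traceFree g
        (fun a b y => contract1 g S (differential t) a b y + pd a t y * pd b t y) i j x
    + 2 * traceFree g (schouten g) i j x

/-! ### The structural equations of abundant manifolds, dimension two -/

/-- The tensor `𝒳 = div_g S + (2/3) S(grad t)`. -/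
def chi {n : ℕ} (g : Tensor2 n) (S : Tensor3 n) (t : Space n → ℝ) : Tensor2 n :=
  fun i j x => div3 g S i j x + 2 / 3 * contract1 g S (differential t) i j x

/-- The tensor `τ` in dimension two. -/
def tau2D {n : ℕ} (g : Tensor2 n) (S : Tensor3 n) (t : Space n → ℝ) : Tensor2 n :=
  fun i j x => 2 / 3 * hessian (christoffel g) t i j x
    - 2 / 3 * contract1 g S (differential t) i j x
    + 1 / 3 * chi g S t i j x
    - 8 / 9 * (pd i t x * pd j t x
        - 1 / 2 * inner1 g (differential t) (differential t) x * g i j x)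
    - 1 / 9 * normSq3 g S x * g i j x - 1 / 2 * scal g x * g i j x

/-- The 1-form `β(X) = tr_g S(X, ·, 𝒳̂(·))`. -/
def beta {n : ℕ} (g : Tensor2 n) (S : Tensor3 n) (t : Space n → ℝ) : Tensor1 n :=
  contract2 g S (chi g S t)

/-- The 1-form `η(X) = tr_g S(X, ·, τ̂(·))`. -/
def eta {n : ℕ} (g : Tensor2 n) (S : Tensor3 n) (t : Space n → ℝ) : Tensor1 n :=
  contract2 g S (tau2D g S t)

/-- The equation for `∇^g S` in dimension two; the last argument of the tensor on the right is the
direction of the derivative. -/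
def DerivativeEq2D {n : ℕ} (g : Tensor2 n) (S : Tensor3 n) (t : Space n → ℝ)
    (x : Space n) : Prop :=
  ∀ i j k l, covDeriv3 (christoffel g) S l i j k x =
    symFirst3TraceFree g (fun a b c d y =>
      -(2 / 3) * S a b c y * pd d t y + 2 * pd a t y * S b c d y
        + chi g S t a b y * g c d y) i j k l x

/-- The equation for `∇^g 𝒳` in dimension two. -/
def ChiEq2D {n : ℕ} (g : Tensor2 n) (S : Tensor3 n) (t : Space n → ℝ) (x : Space n) : Prop :=
  ∀ i j k, covDeriv2 (christoffel g) (chi g S t) k i j x =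
    1 / 3 * normSq3 g S x * S i j k x
    + 4 / 3 * sym2 (fun a b y => beta g S t a y * g b k y
        - 1 / 2 * beta g S t k y * g a b y) i j x
    + 4 / 3 * sym3 (fun a b c y => chi g S t a b y * pd c t y
        - 1 / 2 * g a b y * contract1' g (chi g S t) (differential t) c y) i j k x

/-- The equation for `div_g τ` in dimension two. -/
def DivTauEq2D {n : ℕ} (g : Tensor2 n) (S : Tensor3 n) (t : Space n → ℝ) (x : Space n) : Prop :=
  ∀ i, div2 g (tau2D g S t) i x =
    - eta g S t i x + beta g S t i x
    - 2 / 3 * contract1' g (chi g S t) (differential t) i x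
    - 4 / 9 * contract1' g (contract1 g S (differential t)) (differential t) i x
    - 5 / 9 * normSq3 g S x * pd i t x
    + 1 / 2 * pd i (scal g) x - scal g x * pd i t x

/-! ### The structure equations of a hypersurface with a transversal field

For a hypersurface `f` with transversal field `ξ`, written in coordinates, vectors of the ambient
space are decomposed along the frame `∂₁f, …, ∂ₙf, ξ`. -/

/-- The matrix whose columns are `∂₁f, …, ∂ₙf, ξ`. -/
def adaptedFrame {n : ℕ} (f ξ : Space n → EuclideanSpace ℝ (Fin (n + 1))) (x : Space n) :
    Matrix (Fin (n + 1)) (Fin (n + 1)) ℝ :=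
  Matrix.of fun a b =>
    Fin.snoc (α := fun _ => EuclideanSpace ℝ (Fin (n + 1))) (fun i => pd i f x) (ξ x) b a

/-- The coefficients of a vector `w` of the ambient space with respect to `∂₁f, …, ∂ₙf, ξ`. -/
def frameCoeff {n : ℕ} (f ξ : Space n → EuclideanSpace ℝ (Fin (n + 1))) (x : Space n)
    (w : EuclideanSpace ℝ (Fin (n + 1))) : Fin (n + 1) → ℝ :=
  (adaptedFrame f ξ x)⁻¹.mulVec fun a => w a

/-- The coefficients of the induced connection `∇`, defined by
`∂ᵢ∂ⱼf = ∑ₖ (∇_{∂ᵢ}∂ⱼ)ᵏ ∂ₖf + G(∂ᵢ, ∂ⱼ) ξ`. -/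
def inducedConnection {n : ℕ} (f ξ : Space n → EuclideanSpace ℝ (Fin (n + 1))) : Tensor3 n :=
  fun k i j x => frameCoeff f ξ x (pd i (pd j f) x) k.castSucc

/-- The affine fundamental form `G`. -/
def fundamentalForm {n : ℕ} (f ξ : Space n → EuclideanSpace ℝ (Fin (n + 1))) : Tensor2 n :=
  fun i j x => frameCoeff f ξ x (pd i (pd j f) x) (Fin.last n)

/-- The 1-form `Θ`, defined by `∂ᵢξ = -Â(∂ᵢ) + Θ(∂ᵢ) ξ`. -/
def normalForm {n : ℕ} (f ξ : Space n → EuclideanSpace ℝ (Fin (n + 1))) : Tensor1 n :=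
  fun i x => frameCoeff f ξ x (pd i ξ x) (Fin.last n)

/-- The cubic `C(X, Y, Z) = G(∇_X Y - ∇^G_X Y, Z)`. -/
def cubic {n : ℕ} (f ξ : Space n → EuclideanSpace ℝ (Fin (n + 1))) : Tensor3 n :=
  fun i j k x => ∑ l, fundamentalForm f ξ l k x *
    (inducedConnection f ξ l i j x - christoffel (fundamentalForm f ξ) l i j x)

end Coord

/-! ## Manifolds -/

open Coord

section Manifold

variable (n : ℕ) (M : Type*) [TopologicalSpace M] [ChartedSpace (EuclideanSpace ℝ (Fin n)) M]

/-- A (not necessarily smooth) field of bilinear forms on the tangent spaces. -/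
abbrev TensorField2 : Type _ :=
  ∀ p : M, TangentSpace (𝓡 n) p →ₗ[ℝ] TangentSpace (𝓡 n) p →ₗ[ℝ] ℝ

/-- A (not necessarily smooth) field of trilinear forms on the tangent spaces. -/
abbrev TensorField3 : Type _ :=
  ∀ p : M, TangentSpace (𝓡 n) p →ₗ[ℝ] TangentSpace (𝓡 n) p →ₗ[ℝ] TangentSpace (𝓡 n) p →ₗ[ℝ] ℝ

/-- The charts of the smooth structure of `M`. -/
abbrev Charts : Set (OpenPartialHomeomorph M (EuclideanSpace ℝ (Fin n))) :=
  IsManifold.maximalAtlas (𝓡 n) ∞ M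

variable {n M}

/-- The coordinate vector `∂ᵢ` of a chart, at the point with coordinates `x`. -/
def coordVec (e : OpenPartialHomeomorph M (EuclideanSpace ℝ (Fin n)))
    (x : EuclideanSpace ℝ (Fin n)) (i : Fin n) : TangentSpace (𝓡 n) (e.symm x) :=
  mfderiv (𝓡 n) (𝓡 n) e.symm x (EuclideanSpace.single i (1 : ℝ))

/-- The components of a `(0,2)`-tensor field in a chart. -/
def TensorField2.inChart (B : TensorField2 n M)
    (e : OpenPartialHomeomorph M (EuclideanSpace ℝ (Fin n))) : Tensor2 n :=
  fun i j x => B (e.symm x) (coordVec e x i) (coordVec e x j)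

/-- The components of a `(0,3)`-tensor field in a chart. -/
def TensorField3.inChart (S : TensorField3 n M)
    (e : OpenPartialHomeomorph M (EuclideanSpace ℝ (Fin n))) : Tensor3 n :=
  fun i j k x => S (e.symm x) (coordVec e x i) (coordVec e x j) (coordVec e x k)

/-- A statement about components of tensor fields holds in every chart at every point. -/
def InEveryChart (P : OpenPartialHomeomorph M (EuclideanSpace ℝ (Fin n)) →
    EuclideanSpace ℝ (Fin n) → Prop) : Prop :=
  ∀ e ∈ Charts n M, ∀ x ∈ e.target, P e x

/-- A smooth pseudo-Riemannian metric, of arbitrary signature. -/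
structure IsPseudoRiemannianMetric (g : TensorField2 n M) : Prop where
  symm : ∀ p v w, g p v w = g p w v
  nondegenerate : ∀ p v, (∀ w, g p v w = 0) → v = 0
  smooth : ∀ e ∈ Charts n M, ∀ i j, ContDiffOn ℝ ∞ (g.inChart e i j) e.target

/-- A smooth, totally symmetric `(0,3)`-tensor field that is trace-free with respect to `g`. -/
structure IsSymmetricTraceFree (g : TensorField2 n M) (S : TensorField3 n M) : Prop where
  symm₁₂ : ∀ p u v w, S p u v w = S p v u w
  symm₂₃ : ∀ p u v w, S p u v w = S p u w v
  smooth : ∀ e ∈ Charts n M, ∀ i j k, ContDiffOn ℝ ∞ (S.inChart e i j k) e.target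
  traceFree : InEveryChart fun e x => ∀ k, trace (g.inChart e) (fun i j => S.inChart e i j k) x = 0

/-- Conformal flatness: near every point there are coordinates in which the metric is a positive
function times a constant matrix. -/
def IsConformallyFlat (g : TensorField2 n M) : Prop :=
  ∀ p : M, ∃ e ∈ Charts n M, p ∈ e.source ∧
    ∃ (η : Matrix (Fin n) (Fin n) ℝ) (φ : EuclideanSpace ℝ (Fin n) → ℝ),
      ContDiffOn ℝ ∞ φ e.target ∧
      ∀ x ∈ e.target, ∀ i j, g.inChart e i j x = Real.exp (2 * φ x) * η i j

/-- Abundant manifolds of dimension `n ≥ 3`. -/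
structure IsAbundantHigherDim (g : TensorField2 n M) (S : TensorField3 n M) (t : M → ℝ) :
    Prop where
  three_le : 3 ≤ n
  metric : IsPseudoRiemannianMetric g
  conformallyFlat : IsConformallyFlat g
  symmTraceFree : IsSymmetricTraceFree g S
  smooth : ContMDiff (𝓡 n) 𝓘(ℝ, ℝ) ∞ t
  hessianEq : InEveryChart fun e x => HessianEq (g.inChart e) (S.inChart e) (t ∘ e.symm) x
  derivativeEq : InEveryChart fun e x => DerivativeEq (g.inChart e) (S.inChart e) (t ∘ e.symm) x
  weylEq : InEveryChart fun e x => WeylEq (g.inChart e) (S.inChart e) x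

/-- Abundant manifolds of dimension two. -/
structure IsAbundant2D (g : TensorField2 n M) (S : TensorField3 n M) (t : M → ℝ) : Prop where
  eq_two : n = 2
  metric : IsPseudoRiemannianMetric g
  symmTraceFree : IsSymmetricTraceFree g S
  smooth : ContMDiff (𝓡 n) 𝓘(ℝ, ℝ) ∞ t
  derivativeEq : InEveryChart fun e x => DerivativeEq2D (g.inChart e) (S.inChart e) (t ∘ e.symm) x
  chiEq : InEveryChart fun e x => ChiEq2D (g.inChart e) (S.inChart e) (t ∘ e.symm) x
  divTauEq : InEveryChart fun e x => DivTauEq2D (g.inChart e) (S.inChart e) (t ∘ e.symm) x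
  tau_symm : InEveryChart fun e x => ∀ i j,
    tau2D (g.inChart e) (S.inChart e) (t ∘ e.symm) i j x =
      tau2D (g.inChart e) (S.inChart e) (t ∘ e.symm) j i x
  tau_traceFree : InEveryChart fun e x =>
    trace (g.inChart e) (tau2D (g.inChart e) (S.inChart e) (t ∘ e.symm)) x = 0

/-- Abundant manifolds `(M, g, S, t)`, of dimension `n ≥ 2`. -/
def IsAbundantManifold (g : TensorField2 n M) (S : TensorField3 n M) (t : M → ℝ) : Prop :=
  IsAbundantHigherDim g S t ∨ IsAbundant2D g S t

/-! ## Affine hypersurface normalisations -/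

/-- A smooth immersion `f : M → ℝⁿ⁺¹` with a smooth transversal field `ξ`. -/
structure IsNormalisation (f ξ : M → EuclideanSpace ℝ (Fin (n + 1))) : Prop where
  smooth_f : ContMDiff (𝓡 n) 𝓘(ℝ, EuclideanSpace ℝ (Fin (n + 1))) ∞ f
  smooth_ξ : ContMDiff (𝓡 n) 𝓘(ℝ, EuclideanSpace ℝ (Fin (n + 1))) ∞ ξ
  immersion : ∀ p, Function.Injective
    (mfderiv (𝓡 n) 𝓘(ℝ, EuclideanSpace ℝ (Fin (n + 1))) f p)
  transversal : ∀ p v, mfderiv (𝓡 n) 𝓘(ℝ, EuclideanSpace ℝ (Fin (n + 1))) f p v ≠ ξ p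

/-- A non-degenerate normalisation is relative if its 1-form `Θ` vanishes. -/
structure IsRelativeNormalisation (f ξ : M → EuclideanSpace ℝ (Fin (n + 1))) : Prop
    extends IsNormalisation f ξ where
  nondegenerate : InEveryChart fun e x =>
    (Matrix.of fun i j => fundamentalForm (f ∘ e.symm) (ξ ∘ e.symm) i j x).det ≠ 0
  relative : InEveryChart fun e x => ∀ i, normalForm (f ∘ e.symm) (ξ ∘ e.symm) i x = 0

/-- `(f, ξ)` is the relative normalisation associated to `(M, g, S, t)` (on a connected `M` it is determined up to
affine transformations): its metric is `G = g` and its cubic is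
`C(X, Y, Z) = (1/3) (S(X, Y, Z) + dt(X) g(Y, Z) + dt(Y) g(X, Z) + dt(Z) g(X, Y))`. -/
structure IsAssociatedNormalisation (g : TensorField2 n M) (S : TensorField3 n M) (t : M → ℝ)
    (f ξ : M → EuclideanSpace ℝ (Fin (n + 1))) : Prop
    extends IsRelativeNormalisation f ξ where
  metric_eq : InEveryChart fun e x => ∀ i j,
    fundamentalForm (f ∘ e.symm) (ξ ∘ e.symm) i j x = g.inChart e i j x
  cubic_eq : InEveryChart fun e x => ∀ i j k,
    cubic (f ∘ e.symm) (ξ ∘ e.symm) i j k x = 1 / 3 * (S.inChart e i j k x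
      + pd i (t ∘ e.symm) x * g.inChart e j k x + pd j (t ∘ e.symm) x * g.inChart e i k x
      + pd k (t ∘ e.symm) x * g.inChart e i j x)

/-- A relative normalisation is a graph normalisation if there is a smooth function `F` on `M` such
that the structure equations become `D_X Y = ∇_X Y + (∇²F)(X, Y) ξ` and `D_X ξ = 0`, where `∇` is
the induced connection and `D` the flat connection of the ambient space. -/
def IsGraphNormalisation (f ξ : M → EuclideanSpace ℝ (Fin (n + 1))) : Prop :=
  IsRelativeNormalisation f ξ ∧
  ∃ F : M → ℝ, ContMDiff (𝓡 n) 𝓘(ℝ, ℝ) ∞ F ∧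
    InEveryChart fun e x =>
      (∀ i j, pd i (pd j (f ∘ e.symm)) x =
        ∑ k, inducedConnection (f ∘ e.symm) (ξ ∘ e.symm) k i j x • pd k (f ∘ e.symm) x
        + hessian (inducedConnection (f ∘ e.symm) (ξ ∘ e.symm)) (F ∘ e.symm) i j x • ξ (e.symm x)) ∧
      (∀ i, pd i (ξ ∘ e.symm) x = 0)

/-- A normalisation that is affinely equivalent to a graph normalisation. -/
def IsAffineGraphNormalisation (f ξ : M → EuclideanSpace ℝ (Fin (n + 1))) : Prop :=
  ∃ A : EuclideanSpace ℝ (Fin (n + 1)) ≃ᵃ[ℝ] EuclideanSpace ℝ (Fin (n + 1)),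
    IsGraphNormalisation (fun p => A (f p)) (fun p => A.linear (ξ p))

end Manifold

end

/-! For a relative normalisation the derivative of `ξ` is minus the shape operator `A`, so `ξ` is
locally constant exactly when `A = 0`. This is also what being an affine graph normalisation amounts
to. An affine map has an injective linear part, so a parallel image of `ξ` forces `ξ` to be
parallel. Conversely, if `ξ` is parallel, then `F = ⟨ξ, f⟩ / ⟨ξ, ξ⟩` is locally a fixed linear
functional of `f` with value 1 on `ξ`; applying it to the structure equation gives `∇²F = G`
(`hessian_of_parallel_transversal`). It remains to express `A = 0` through `(g, S, t)`.

The induced connection is `∇^g + Ĉ`, and commuting third derivatives of `f` give the Gauss equation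
`R(X,Y)Z = G(Y,Z)AX - G(X,Z)AY` (`curvature_eq_of_structure`). The connection `∇^g - Ĉ` is dual to
it with respect to `g`, so its curvature is minus the `g`-adjoint and is determined by `A` as well
(`curvature_add_curvature_of_dual`, `ricci_of_dual`). Writing `L = g(A·,·)`, the two Ricci tensors
are `(tr A) g - L` and `(n-1) L`. Half their sum is `Ric^g` plus a quadratic expression in `C`, and
half their difference is `div C - ∇^g(tr C)`. Thus `2 (Ric^g + quadratic) = (tr A) g + (n-2) L`
(`gauss_even`), `2 (div C - ∇^g(tr C)) = (tr A) g - n L` (`gauss_odd`).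

If `n ≥ 3`, the even equation alone determines `A`, so `A = 0` means that `gaussTensor` vanishes.
Its trace is the scalar curvature condition, and its trace-free part is a nonzero multiple of `P° -
τ/8`. If `n = 2`, the coefficient `n - 2` vanishes and the even equation sees only `tr A`, which
again gives the scalar curvature condition. The trace-free part of `A` then comes from the odd
equation, where the Laplacian of `t` is eliminated using that `τ` is trace-free. -/

namespace Coord

variable {n : ℕ} {V : Type*} [NormedAddCommGroup V] [NormedSpace ℝ V]

/-! ### Partial derivatives -/

theorem differentiableAt_of_contDiffOn {U : Set (Space n)} (hU : IsOpen U) {f : Space n → V}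
    (hf : ContDiffOn ℝ ∞ f U) {x : Space n} (hx : x ∈ U) : DifferentiableAt ℝ f x :=
  (hf.contDiffAt (hU.mem_nhds hx)).differentiableAt (by simp)

theorem contDiffOn_pd {U : Set (Space n)} (hU : IsOpen U) {f : Space n → V}
    (hf : ContDiffOn ℝ ∞ f U) (i : Fin n) : ContDiffOn ℝ ∞ (pd i f) U :=
  (hf.fderiv_of_isOpen hU (by simp)).clm_apply contDiffOn_const

theorem pd_congr_of_eqOn {U : Set (Space n)} (hU : IsOpen U) {f h : Space n → V}
    (hfh : ∀ y ∈ U, f y = h y) {x : Space n} (hx : x ∈ U) (i : Fin n) : pd i f x = pd i h x := by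
  have : f =ᶠ[nhds x] h := Filter.eventuallyEq_of_mem (hU.mem_nhds hx) hfh
  simp only [pd, this.fderiv_eq]

theorem pd_add {f h : Space n → V} {x : Space n} (hf : DifferentiableAt ℝ f x)
    (hh : DifferentiableAt ℝ h x) (i : Fin n) :
    pd i (fun y => f y + h y) x = pd i f x + pd i h x := by
  simp [pd, fderiv_fun_add hf hh]

theorem pd_sub {f h : Space n → V} {x : Space n} (hf : DifferentiableAt ℝ f x)
    (hh : DifferentiableAt ℝ h x) (i : Fin n) :
    pd i (fun y => f y - h y) x = pd i f x - pd i h x := by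
  simp [pd, fderiv_fun_sub hf hh]

theorem pd_sum {ι : Type*} {s : Finset ι} {f : ι → Space n → V} {x : Space n}
    (hf : ∀ a ∈ s, DifferentiableAt ℝ (f a) x) (i : Fin n) :
    pd i (fun y => ∑ a ∈ s, f a y) x = ∑ a ∈ s, pd i (f a) x := by
  simp [pd, fderiv_fun_sum hf]

theorem pd_smul {c : Space n → ℝ} {f : Space n → V} {x : Space n} (hc : DifferentiableAt ℝ c x)
    (hf : DifferentiableAt ℝ f x) (i : Fin n) :
    pd i (fun y => c y • f y) x = c x • pd i f x + pd i c x • f x := by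
  simp [pd, fderiv_fun_smul hc hf]

theorem pd_mul {c f : Space n → ℝ} {x : Space n} (hc : DifferentiableAt ℝ c x)
    (hf : DifferentiableAt ℝ f x) (i : Fin n) :
    pd i (fun y => c y * f y) x = c x * pd i f x + pd i c x * f x := by
  simpa using pd_smul hc hf i

theorem pd_const_mul {f : Space n → ℝ} {x : Space n} (c : ℝ)
    (hf : DifferentiableAt ℝ f x) (i : Fin n) :
    pd i (fun y => c * f y) x = c * pd i f x := by
  simp [pd, fderiv_const_mul hf]

theorem pd_clm_comp {W : Type*} [NormedAddCommGroup W] [NormedSpace ℝ W] (L : V →L[ℝ] W)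
    {f : Space n → V} {x : Space n} (hf : DifferentiableAt ℝ f x) (i : Fin n) :
    pd i (fun y => L (f y)) x = L (pd i f x) := by
  have : fderiv ℝ (fun y => L (f y)) x = L.comp (fderiv ℝ f x) :=
    (L.hasFDerivAt.comp x hf.hasFDerivAt).fderiv
  simp [pd, this]

theorem pd_comm {U : Set (Space n)} (hU : IsOpen U) {f : Space n → V}
    (hf : ContDiffOn ℝ ∞ f U) {x : Space n} (hx : x ∈ U) (i j : Fin n) :
    pd i (pd j f) x = pd j (pd i f) x := by
  have h2 : DifferentiableAt ℝ (fderiv ℝ f) x :=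
    differentiableAt_of_contDiffOn hU (hf.fderiv_of_isOpen hU (by simp)) hx
  have hs : IsSymmSndFDerivAt ℝ f x :=
    (hf.contDiffAt (hU.mem_nhds hx)).isSymmSndFDerivAt
        (by simpa using WithTop.coe_le_coe.2 (le_top : (2 : ℕ∞) ≤ ⊤))
  have key (a b : Fin n) : pd a (pd b f) x = fderiv ℝ (fderiv ℝ f) x
      (EuclideanSpace.single a 1) (EuclideanSpace.single b 1) := by
    have := h2.hasFDerivAt.clm_apply
      (hasFDerivAt_const (EuclideanSpace.single b (1 : ℝ)) x)
    have h3 : fderiv ℝ (pd b f) x = _ := this.fderiv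
    simp [pd, h3]
  rw [key, key]
  exact hs _ _

/-! ### The inverse metric -/

/-- The values of a `(0,2)`-tensor at a point, as a matrix. -/
abbrev mat (g : Tensor2 n) (x : Space n) : Matrix (Fin n) (Fin n) ℝ := Matrix.of fun a b => g a b x

theorem inv_mul_metric {g : Tensor2 n} {x : Space n} (hg : (mat g x).det ≠ 0) (i j : Fin n) :
    ∑ k, inv g i k x * g k j x = if i = j then 1 else 0 := by
  have h := congrFun (congrFun (Matrix.nonsing_inv_mul (mat g x) hg.isUnit) i) j
  simpa [Matrix.mul_apply, Matrix.one_apply, inv] using h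

theorem metric_mul_inv {g : Tensor2 n} {x : Space n} (hg : (mat g x).det ≠ 0) (i j : Fin n) :
    ∑ k, g i k x * inv g k j x = if i = j then 1 else 0 := by
  have h := congrFun (congrFun (Matrix.mul_nonsing_inv (mat g x) hg.isUnit) i) j
  simpa [Matrix.mul_apply, Matrix.one_apply, inv] using h

theorem inv_symm {g : Tensor2 n} (hs : ∀ i j, g i j = g j i) (i j : Fin n) (x : Space n) :
    inv g i j x = inv g j i x := by
  have h : (mat g x).transpose = mat g x := by
    ext a b
    simp [hs a b]
  have h' : ((mat g x)⁻¹).transpose = (mat g x)⁻¹ := by rw [Matrix.transpose_nonsing_inv, h]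
  exact congrFun (congrFun h' j) i

theorem contDiffOn_det {m : ℕ} {A : Fin m → Fin m → Space n → ℝ} {U : Set (Space n)}
    (hA : ∀ i j, ContDiffOn ℝ ∞ (A i j) U) :
    ContDiffOn ℝ ∞ (fun x => (Matrix.of fun a b => A a b x).det) U := by
  simp only [Matrix.det_apply', Matrix.of_apply]
  exact ContDiffOn.sum fun σ _ => contDiffOn_const.mul (contDiffOn_prod fun i _ => hA _ _)

/-- Cramer's rule: each entry of the adjugate is the determinant of the matrix with one row replaced
by a unit vector, so everything reduces to smoothness of determinants. -/
theorem contDiffOn_inv {g : Tensor2 n} {U : Set (Space n)}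
    (hg : ∀ i j, ContDiffOn ℝ ∞ (g i j) U) (hdet : ∀ x ∈ U, (mat g x).det ≠ 0) (i j : Fin n) :
    ContDiffOn ℝ ∞ (inv g i j) U := by
  have h : inv g i j = fun x => ((mat g x).det)⁻¹ * (mat g x).adjugate i j := by
    funext x
    simp [inv, Matrix.inv_def]
  rw [h]
  refine ((contDiffOn_det hg).inv hdet).mul ?_
  have h2 : (fun x => (mat g x).adjugate i j) = fun x =>
      (Matrix.of fun a b => (fun y : Space n => if a = j then Pi.single (M := fun _ => ℝ) i 1 b
        else g a b y) x).det := by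
    funext x
    rw [Matrix.adjugate_apply]
    congr 1
    ext a b
    simp only [Matrix.updateRow_apply, Matrix.of_apply]
  rw [h2]
  refine contDiffOn_det fun a b => ?_
  by_cases hab : a = j
  · simpa [hab] using contDiffOn_const
  · simpa [hab] using hg a b

/-! ### The Gauss equation -/

/-- Differentiating the structure equation once and substituting it again re-expands the third
derivatives of `f` in the frame. The tangential coefficients contain half of the curvature of `Γ`
together with a shape term. -/
theorem pd_pd_pd_of_structure {U : Set (Space n)} (hU : IsOpen U) {f ξ : Space n → V}
    (hf : ContDiffOn ℝ ∞ f U) (hξ : ContDiffOn ℝ ∞ ξ U) {Γ : Tensor3 n} {G : Tensor2 n}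
    (hΓ : ∀ i j k, ContDiffOn ℝ ∞ (Γ i j k) U) (hG : ∀ i j, ContDiffOn ℝ ∞ (G i j) U)
    (hstr : ∀ y ∈ U, ∀ i j, pd i (pd j f) y = ∑ k, Γ k i j y • pd k f y + G i j y • ξ y)
    {x : Space n} (hx : x ∈ U) {a : Fin n → Fin n → ℝ}
    (ha : ∀ i, pd i ξ x = -∑ k, a k i • pd k f x) (l i j : Fin n) :
    pd l (pd i (pd j f)) x =
      ∑ k, (pd l (Γ k i j) x + ∑ m, Γ k l m x * Γ m i j x - G i j x * a k l) • pd k f x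
      + (pd l (G i j) x + ∑ m, Γ m i j x * G l m x) • ξ x := by
  have hd (k : Fin n) : DifferentiableAt ℝ (pd k f) x :=
    differentiableAt_of_contDiffOn hU (contDiffOn_pd hU hf k) hx
  have hdΓ (k : Fin n) : DifferentiableAt ℝ (Γ k i j) x :=
    differentiableAt_of_contDiffOn hU (hΓ k i j) hx
  have hdG : DifferentiableAt ℝ (G i j) x := differentiableAt_of_contDiffOn hU (hG i j) hx
  have hdξ : DifferentiableAt ℝ ξ x := differentiableAt_of_contDiffOn hU hξ hx
  rw [pd_congr_of_eqOn hU (fun y hy => hstr y hy i j) hx l,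
    pd_add (DifferentiableAt.fun_sum fun k _ => (hdΓ k).fun_smul (hd k)) (hdG.fun_smul hdξ),
    pd_sum fun k _ => (hdΓ k).fun_smul (hd k), pd_smul hdG hdξ, ha]
  have h1 : ∀ k, pd l (fun y => Γ k i j y • pd k f y) x =
      Γ k i j x • (∑ m, Γ m l k x • pd m f x + G l k x • ξ x) + pd l (Γ k i j) x • pd k f x :=
    fun k => by rw [pd_smul (hdΓ k) (hd k), hstr x hx]
  simp only [h1, smul_add, Finset.sum_add_distrib, Finset.smul_sum, sub_smul, add_smul,
    Finset.sum_sub_distrib, Finset.sum_smul, smul_neg, smul_smul]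
  rw [Finset.sum_comm (f := fun k m => (Γ k i j x * Γ m l k x) • pd m f x)]
  simp only [mul_comm (Γ _ i j x) (Γ _ l _ x)]
  abel

theorem curvature_eq_of_structure {U : Set (Space n)} (hU : IsOpen U) {f ξ : Space n → V}
    (hf : ContDiffOn ℝ ∞ f U) (hξ : ContDiffOn ℝ ∞ ξ U) {Γ : Tensor3 n} {G : Tensor2 n}
    (hΓ : ∀ i j k, ContDiffOn ℝ ∞ (Γ i j k) U) (hG : ∀ i j, ContDiffOn ℝ ∞ (G i j) U)
    (hstr : ∀ y ∈ U, ∀ i j, pd i (pd j f) y = ∑ k, Γ k i j y • pd k f y + G i j y • ξ y)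
    {x : Space n} (hx : x ∈ U) {a : Fin n → Fin n → ℝ}
    (ha : ∀ i, pd i ξ x = -∑ k, a k i • pd k f x)
    (hframe : ∀ (c : Fin n → ℝ) (d : ℝ), ∑ k, c k • pd k f x + d • ξ x = 0 → ∀ k, c k = 0)
    (k l i j : Fin n) :
    curvature Γ k l i j x = G i j x * a k l - G l j x * a k i := by
  -- Third derivatives are symmetric in `l` and `i`. Comparing tangential coefficients gives the
  -- Gauss equation; the normal coefficient, which would give Codazzi, is not needed.
  have h := pd_comm hU (contDiffOn_pd hU hf j) hx l i
  rw [pd_pd_pd_of_structure hU hf hξ hΓ hG hstr hx ha,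
    pd_pd_pd_of_structure hU hf hξ hΓ hG hstr hx ha, ← sub_eq_zero, add_sub_add_comm, ← sub_smul,
    ← Finset.sum_sub_distrib] at h
  simp only [← sub_smul] at h
  have := hframe _ _ h k
  simp only [curvature, Finset.sum_sub_distrib]
  linarith

/-! ### Connections that are dual with respect to a metric -/

/-- The terms are grouped so that the mixed products `Γ₁ Γ₂` form a pair exchanged by `l ↔ i`. They
cancel on antisymmetrising, and only the two curvatures survive. -/
theorem pd_pd_metric {U : Set (Space n)} (hU : IsOpen U) {g : Tensor2 n} {Γ₁ Γ₂ : Tensor3 n}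
    (hg : ∀ i j, ContDiffOn ℝ ∞ (g i j) U) (hΓ₁ : ∀ i j k, ContDiffOn ℝ ∞ (Γ₁ i j k) U)
    (hΓ₂ : ∀ i j k, ContDiffOn ℝ ∞ (Γ₂ i j k) U)
    (hdual : ∀ y ∈ U, ∀ i j k,
      pd i (g j k) y = ∑ m, (Γ₁ m i j y * g m k y + Γ₂ m i k y * g j m y))
    {x : Space n} (hx : x ∈ U) (l i j k : Fin n) :
    pd l (pd i (g j k)) x =
      ∑ m, (pd l (Γ₁ m i j) x + ∑ p, Γ₁ m l p x * Γ₁ p i j x) * g m k x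
      + ∑ m, (pd l (Γ₂ m i k) x + ∑ p, Γ₂ m l p x * Γ₂ p i k x) * g j m x
      + (∑ m, ∑ p, Γ₁ m i j x * Γ₂ p l k x * g m p x
        + ∑ m, ∑ p, Γ₁ m l j x * Γ₂ p i k x * g m p x) := by
  have hd {h : Space n → ℝ} (hh : ContDiffOn ℝ ∞ h U) : DifferentiableAt ℝ h x :=
    differentiableAt_of_contDiffOn hU hh hx
  rw [pd_congr_of_eqOn hU (fun y hy => hdual y hy i j k) hx l, pd_sum fun m _ =>
    ((hd (hΓ₁ m i j)).fun_mul (hd (hg m k))).fun_add ((hd (hΓ₂ m i k)).fun_mul (hd (hg j m)))]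
  have h1 (m : Fin n) : pd l (fun y => Γ₁ m i j y * g m k y + Γ₂ m i k y * g j m y) x =
      Γ₁ m i j x * (∑ p, (Γ₁ p l m x * g p k x + Γ₂ p l k x * g m p x))
        + pd l (Γ₁ m i j) x * g m k x
      + (Γ₂ m i k x * (∑ p, (Γ₁ p l j x * g p m x + Γ₂ p l m x * g j p x))
        + pd l (Γ₂ m i k) x * g j m x) := by
    rw [pd_add ((hd (hΓ₁ m i j)).fun_mul (hd (hg m k))) ((hd (hΓ₂ m i k)).fun_mul (hd (hg j m))),
      pd_mul (hd (hΓ₁ m i j)) (hd (hg m k)), pd_mul (hd (hΓ₂ m i k)) (hd (hg j m)),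
      hdual x hx, hdual x hx]
  simp only [h1, add_mul, mul_add, Finset.sum_add_distrib, Finset.mul_sum, Finset.sum_mul]
  rw [Finset.sum_comm (f := fun m p => Γ₁ m i j x * (Γ₁ p l m x * g p k x)),
    Finset.sum_comm (f := fun m p => Γ₂ m i k x * (Γ₂ p l m x * g j p x)),
    Finset.sum_comm (f := fun m p => Γ₂ m i k x * (Γ₁ p l j x * g p m x))]
  have e1 (m p : Fin n) : Γ₁ p i j x * (Γ₁ m l p x * g m k x) =
    Γ₁ m l p x * Γ₁ p i j x * g m k x := by ring
  have e2 (m p : Fin n) : Γ₂ p i k x * (Γ₂ m l p x * g j m x) =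
    Γ₂ m l p x * Γ₂ p i k x * g j m x := by ring
  have e3 (m p : Fin n) : Γ₂ p i k x * (Γ₁ m l j x * g m p x) =
    Γ₁ m l j x * Γ₂ p i k x * g m p x := by ring
  have e4 (m p : Fin n) : Γ₁ m i j x * (Γ₂ p l k x * g m p x) =
    Γ₁ m i j x * Γ₂ p l k x * g m p x := by ring
  simp only [e1, e2, e3, e4]
  ring

theorem curvature_add_curvature_of_dual {U : Set (Space n)} (hU : IsOpen U) {g : Tensor2 n}
    {Γ₁ Γ₂ : Tensor3 n} (hg : ∀ i j, ContDiffOn ℝ ∞ (g i j) U)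
    (hΓ₁ : ∀ i j k, ContDiffOn ℝ ∞ (Γ₁ i j k) U) (hΓ₂ : ∀ i j k, ContDiffOn ℝ ∞ (Γ₂ i j k) U)
    (hdual : ∀ y ∈ U, ∀ i j k,
      pd i (g j k) y = ∑ m, (Γ₁ m i j y * g m k y + Γ₂ m i k y * g j m y))
    {x : Space n} (hx : x ∈ U) (l i j k : Fin n) :
    ∑ m, curvature Γ₁ m l i j x * g m k x + ∑ m, curvature Γ₂ m l i k x * g j m x = 0 := by
  have h := pd_comm hU (hg j k) hx l i
  rw [pd_pd_metric hU hg hΓ₁ hΓ₂ hdual hx, pd_pd_metric hU hg hΓ₁ hΓ₂ hdual hx] at h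
  simp only [curvature, Finset.sum_sub_distrib, add_mul, sub_mul, Finset.sum_add_distrib] at h ⊢
  linarith

/-- The Ricci tensor of the second of two dual connections, when the curvature of the first is that
of a hypersurface with shape operator `a`. -/
theorem ricci_of_dual {U : Set (Space n)} (hU : IsOpen U) {g : Tensor2 n}
    {Γ₁ Γ₂ : Tensor3 n} (hg : ∀ i j, ContDiffOn ℝ ∞ (g i j) U)
    (hsymm : ∀ i j, g i j = g j i)
    (hΓ₁ : ∀ i j k, ContDiffOn ℝ ∞ (Γ₁ i j k) U) (hΓ₂ : ∀ i j k, ContDiffOn ℝ ∞ (Γ₂ i j k) U)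
    (hdual : ∀ y ∈ U, ∀ i j k,
      pd i (g j k) y = ∑ m, (Γ₁ m i j y * g m k y + Γ₂ m i k y * g j m y))
    {x : Space n} (hx : x ∈ U) (hdet : (mat g x).det ≠ 0) {a : Fin n → Fin n → ℝ}
    (ha : ∀ k l i j, curvature Γ₁ k l i j x = g i j x * a k l - g l j x * a k i) (j k : Fin n) :
    ricci Γ₂ j k x = ((n : ℝ) - 1) * ∑ m, g m k x * a m j := by
  -- Duality turns the Gauss equation into the lowered curvature of `Γ₂`; `h2` raises the index, and
  -- in `ricci` the two Kronecker deltas trace to `n` and `1`, whence the factor `n - 1`.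
  have h1 (l i q : Fin n) : ∑ m, g q m x * curvature Γ₂ m l i k x =
      g l q x * (∑ m, g m k x * a m i) - g i q x * ∑ m, g m k x * a m l := by
    have h := curvature_add_curvature_of_dual hU hg hΓ₁ hΓ₂ hdual hx l i q k
    simp only [ha, sub_mul, Finset.sum_sub_distrib, mul_assoc, ← Finset.mul_sum] at h
    simp only [mul_comm (g q _ x), mul_comm (g _ k x)]
    linarith
  have h2 (p l i : Fin n) : curvature Γ₂ p l i k x =
      (if p = l then 1 else 0) * (∑ m, g m k x * a m i)
        - (if p = i then 1 else 0) * ∑ m, g m k x * a m l := by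
    have h3 : ∑ q, inv g p q x * ∑ m, g q m x * curvature Γ₂ m l i k x =
        curvature Γ₂ p l i k x := by
      simp only [Finset.mul_sum, ← mul_assoc]
      rw [Finset.sum_comm]
      simp [← Finset.sum_mul, inv_mul_metric hdet]
    rw [← h3]
    simp only [h1, mul_sub, ← mul_assoc, Finset.sum_sub_distrib, ← Finset.sum_mul]
    simp only [hsymm l, hsymm i, inv_mul_metric hdet]
  simp only [ricci, h2]
  simp [Finset.sum_sub_distrib]
  ring

theorem ricci_of_curvature {g : Tensor2 n} {Γ : Tensor3 n} {x : Space n} {a : Fin n → Fin n → ℝ}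
    (ha : ∀ k l i j, curvature Γ k l i j x = g i j x * a k l - g l j x * a k i) (j k : Fin n) :
    ricci Γ j k x = g j k x * (∑ m, a m m) - ∑ m, g m k x * a m j := by
  simp only [ricci, ha, Finset.sum_sub_distrib, Finset.mul_sum]

/-! ### Changing a connection by a tensor -/

/-- Curvature is at most quadratic in the connection, so the terms linear in `D`, including all its
derivatives, cancel in the sum. -/
theorem ricci_add_add_ricci_sub {Γ D : Tensor3 n} {x : Space n}
    (hΓ : ∀ i j k, DifferentiableAt ℝ (Γ i j k) x)
    (hD : ∀ i j k, DifferentiableAt ℝ (D i j k) x) (j k : Fin n) :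
    ricci (fun k i j y => Γ k i j y + D k i j y) j k x
      + ricci (fun k i j y => Γ k i j y - D k i j y) j k x =
    2 * (ricci Γ j k x + ∑ i, ∑ m, (D i i m x * D m j k x - D i j m x * D m i k x)) := by
  simp only [ricci, curvature, pd_add (hΓ _ _ _) (hD _ _ _), pd_sub (hΓ _ _ _) (hD _ _ _)]
  rw [← Finset.sum_add_distrib, ← Finset.sum_add_distrib, Finset.mul_sum]
  refine Finset.sum_congr rfl fun i _ => ?_
  have h (A B : Fin n → ℝ) (p q r s : ℝ) (T W : Fin n → ℝ)
      (hT : ∀ m, A m + B m = 2 * (T m + W m)) :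
      (p + r - (q + s) + ∑ m, A m) + (p - r - (q - s) + ∑ m, B m) =
      2 * (p - q + ∑ m, T m + ∑ m, W m) := by
    have : ∑ m, A m + ∑ m, B m = 2 * (∑ m, T m + ∑ m, W m) := by
      simp only [← Finset.sum_add_distrib, Finset.mul_sum, hT]
    linarith
  exact h _ _ _ _ _ _ _ _ fun m => by ring

/-- Only the terms linear in `D` survive. For torsion-free `Γ` they assemble into the covariant
divergence of `D` minus the covariant derivative of its trace. -/
theorem ricci_add_sub_ricci_sub {Γ D : Tensor3 n} {x : Space n}
    (hΓ : ∀ i j k, DifferentiableAt ℝ (Γ i j k) x)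
    (hD : ∀ i j k, DifferentiableAt ℝ (D i j k) x) (j k : Fin n) :
    ricci (fun k i j y => Γ k i j y + D k i j y) j k x
      - ricci (fun k i j y => Γ k i j y - D k i j y) j k x =
    2 * ∑ i, (pd i (D i j k) x - pd j (D i i k) x + ∑ m, (Γ i i m x * D m j k x
      + D i i m x * Γ m j k x - Γ i j m x * D m i k x - D i j m x * Γ m i k x)) := by
  simp only [ricci, curvature, pd_add (hΓ _ _ _) (hD _ _ _), pd_sub (hΓ _ _ _) (hD _ _ _)]
  rw [← Finset.sum_sub_distrib, Finset.mul_sum]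
  refine Finset.sum_congr rfl fun i _ => ?_
  have h (A B : Fin n → ℝ) (p q r s : ℝ) (T : Fin n → ℝ)
      (hT : ∀ m, A m - B m = 2 * T m) :
      (p + r - (q + s) + ∑ m, A m) - (p - r - (q - s) + ∑ m, B m) =
      2 * (r - s + ∑ m, T m) := by
    have : ∑ m, A m - ∑ m, B m = 2 * ∑ m, T m := by
      simp only [← Finset.sum_sub_distrib, Finset.mul_sum, hT]
    linarith
  exact h _ _ _ _ _ _ _ fun m => by ring

/-! ### The Levi-Civita connection and its deformation by a cubic form -/

theorem metric_mul_inv_apply {g : Tensor2 n} {x : Space n} (hdet : (mat g x).det ≠ 0)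
    (v : Fin n → ℝ) (k : Fin n) : ∑ m, g k m x * ∑ l, inv g m l x * v l = v k := by
  simp only [Finset.mul_sum, ← mul_assoc]
  rw [Finset.sum_comm]
  simp [← Finset.sum_mul, metric_mul_inv hdet]

theorem inv_mul_metric_apply {g : Tensor2 n} {x : Space n} (hdet : (mat g x).det ≠ 0)
    (v : Fin n → ℝ) (k : Fin n) : ∑ m, inv g k m x * ∑ l, g m l x * v l = v k := by
  simp only [Finset.mul_sum, ← mul_assoc]
  rw [Finset.sum_comm]
  simp [← Finset.sum_mul, inv_mul_metric hdet]

theorem metric_mul_hat {g : Tensor2 n} {x : Space n} (hdet : (mat g x).det ≠ 0) (S : Tensor3 n)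
    (i j k : Fin n) : ∑ m, g k m x * hat g S m i j x = S i j k x :=
  metric_mul_inv_apply hdet (fun l => S i j l x) k

theorem metric_mul_christoffel {g : Tensor2 n} {x : Space n} (hdet : (mat g x).det ≠ 0)
    (i j k : Fin n) : ∑ m, g k m x * christoffel g m i j x =
      1 / 2 * (pd i (g j k) x + pd j (g i k) x - pd k (g i j) x) := by
  rw [← metric_mul_inv_apply hdet
    (fun l => 1 / 2 * (pd i (g j l) x + pd j (g i l) x - pd l (g i j) x)) k]
  simp only [christoffel, Finset.mul_sum]
  exact Finset.sum_congr rfl fun _ _ => Finset.sum_congr rfl fun _ _ => by ring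

theorem christoffel_symm {g : Tensor2 n} (hsymm : ∀ i j, g i j = g j i) (k i j : Fin n) :
    christoffel g k i j = christoffel g k j i := by
  funext x
  simp only [christoffel, hsymm j i, add_comm (pd i (g j _) x)]

theorem pd_metric {g : Tensor2 n} {x : Space n} (hsymm : ∀ i j, g i j = g j i)
    (hdet : (mat g x).det ≠ 0) (i j k : Fin n) :
    pd i (g j k) x = ∑ m, christoffel g m i j x * g m k x
        + ∑ m, christoffel g m i k x * g j m x := by
  simp only [hsymm _ k, mul_comm (christoffel g _ _ _ x)]
  rw [metric_mul_christoffel hdet, metric_mul_christoffel hdet, hsymm k j, hsymm i j]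
  ring

/-- The connections `∇^g ± Ĉ` are dual with respect to `g`. -/
theorem pd_metric_dual {g : Tensor2 n} {C : Tensor3 n} {x : Space n}
    (hsymm : ∀ i j, g i j = g j i) (hC : ∀ i j k, C i j k = C i k j)
    (hdet : (mat g x).det ≠ 0) (i j k : Fin n) :
    pd i (g j k) x = ∑ m, ((christoffel g m i j x + hat g C m i j x) * g m k x
      + (christoffel g m i k x - hat g C m i k x) * g j m x) := by
  have h1 := metric_mul_hat hdet C i j k
  have h2 := metric_mul_hat hdet C i k j
  have h3 := pd_metric hsymm hdet i j k
  simp only [hsymm k] at h1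
  simp only [mul_comm (g _ _ x)] at h1 h2
  simp only [add_mul, sub_mul, Finset.sum_add_distrib, Finset.sum_sub_distrib]
  rw [h1, h2, h3, hC i j k]
  ring

theorem contDiffOn_hat {U : Set (Space n)} {g : Tensor2 n} {S : Tensor3 n}
    (hg : ∀ i j, ContDiffOn ℝ ∞ (g i j) U) (hdet : ∀ x ∈ U, (mat g x).det ≠ 0)
    (hS : ∀ i j k, ContDiffOn ℝ ∞ (S i j k) U) (i j k : Fin n) :
    ContDiffOn ℝ ∞ (hat g S i j k) U :=
  ContDiffOn.sum fun l _ => (contDiffOn_inv hg hdet i l).mul (hS j k l)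

theorem contDiffOn_christoffel {U : Set (Space n)} (hU : IsOpen U) {g : Tensor2 n}
    (hg : ∀ i j, ContDiffOn ℝ ∞ (g i j) U) (hdet : ∀ x ∈ U, (mat g x).det ≠ 0) (i j k : Fin n) :
    ContDiffOn ℝ ∞ (christoffel g i j k) U :=
  contDiffOn_const.mul (ContDiffOn.sum fun l _ => (contDiffOn_inv hg hdet i l).mul
    (((contDiffOn_pd hU (hg k l) j).add (contDiffOn_pd hU (hg j l) k)).sub
      (contDiffOn_pd hU (hg j k) l)))

/-- The covariant derivative of a cubic form, in terms of that of the associated `(1,2)`-tensor. -/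
theorem covDeriv3_eq {U : Set (Space n)} (hU : IsOpen U) {g : Tensor2 n} {C : Tensor3 n}
    (hg : ∀ i j, ContDiffOn ℝ ∞ (g i j) U) (hdet : ∀ x ∈ U, (mat g x).det ≠ 0)
    (hsymm : ∀ i j, g i j = g j i) (hC : ∀ i j k, ContDiffOn ℝ ∞ (C i j k) U)
    (hcyc : ∀ i j k, C i j k = C j k i) {x : Space n} (hx : x ∈ U) (a b j k : Fin n) :
    covDeriv3 (christoffel g) C a b j k x = ∑ m, g b m x * (pd a (hat g C m j k) x
      + ∑ p, (christoffel g m a p x * hat g C p j k x - christoffel g p a j x * hat g C m p k x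
        - christoffel g p a k x * hat g C m j p x)) := by
  have hd {h : Space n → ℝ} (hh : ContDiffOn ℝ ∞ h U) : DifferentiableAt ℝ h x :=
    differentiableAt_of_contDiffOn hU hh hx
  -- `hat` raises the last slot while the divergence contracts the first, hence the cyclic symmetry.
  -- The derivative of the lowering metric is then absorbed by metric compatibility.
  have hl (y : Space n) (hy : y ∈ U) (i j b : Fin n) :
      C b i j y = ∑ m, g b m y * hat g C m i j y := by
    rw [metric_mul_hat (hdet y hy), hcyc]
  have h1 (m : Fin n) : pd a (fun y => g b m y * hat g C m j k y) x =
      g b m x * pd a (hat g C m j k) x + (∑ p, christoffel g p a b x * g p m x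
        + ∑ p, christoffel g p a m x * g b p x) * hat g C m j k x := by
    rw [pd_mul (hd (hg b m)) (hd (contDiffOn_hat hg hdet hC m j k)),
      ← pd_metric hsymm (hdet x hx)]
  rw [covDeriv3, pd_congr_of_eqOn hU (fun y hy => hl y hy j k b) hx,
    pd_sum fun m _ => (hd (hg b m)).fun_mul (hd (contDiffOn_hat hg hdet hC m j k))]
  simp only [h1, hl x hx, mul_add, add_mul, mul_sub, Finset.mul_sum, Finset.sum_mul,
    Finset.sum_add_distrib, Finset.sum_sub_distrib]
  rw [Finset.sum_comm (f := fun m p => christoffel g p a b x * g p m x * hat g C m j k x),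
    Finset.sum_comm (f := fun m p => christoffel g p a m x * g b p x * hat g C m j k x),
    Finset.sum_comm (f := fun m p => g b m x * (christoffel g p a j x * hat g C m p k x)),
    Finset.sum_comm (f := fun m p => g b m x * (christoffel g p a k x * hat g C m j p x))]
  have e1 (m p : Fin n) : christoffel g m a p x * g b m x * hat g C p j k x =
    g b m x * (christoffel g m a p x * hat g C p j k x) := by ring
  have e2 (q m p : Fin n) (r : ℝ) : christoffel g p a q x * (g b m x * r) =
    g b m x * (christoffel g p a q x * r) := by ring
  simp only [e1, e2, mul_assoc]
  ring

theorem div3_eq {U : Set (Space n)} (hU : IsOpen U) {g : Tensor2 n} {C : Tensor3 n}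
    (hg : ∀ i j, ContDiffOn ℝ ∞ (g i j) U) (hdet : ∀ x ∈ U, (mat g x).det ≠ 0)
    (hsymm : ∀ i j, g i j = g j i) (hC : ∀ i j k, ContDiffOn ℝ ∞ (C i j k) U)
    (hcyc : ∀ i j k, C i j k = C j k i) {x : Space n} (hx : x ∈ U) (j k : Fin n) :
    div3 g C j k x = ∑ a, (pd a (hat g C a j k) x
      + ∑ p, (christoffel g a a p x * hat g C p j k x - christoffel g p a j x * hat g C a p k x
        - christoffel g p a k x * hat g C a j p x)) := by
  simp only [div3, covDeriv3_eq hU hg hdet hsymm hC hcyc hx]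
  exact Finset.sum_congr rfl fun a _ => inv_mul_metric_apply (hdet x hx) _ a

/-- The curvature identities of `∇^g + Ĉ` when it is the induced connection of a hypersurface with
shape operator `a`: the part of the Gauss equation even in `C`. -/
theorem gauss_even {U : Set (Space n)} (hU : IsOpen U) {g : Tensor2 n} {C : Tensor3 n}
    (hg : ∀ i j, ContDiffOn ℝ ∞ (g i j) U) (hdet : ∀ x ∈ U, (mat g x).det ≠ 0)
    (hsymm : ∀ i j, g i j = g j i) (hC : ∀ i j k, ContDiffOn ℝ ∞ (C i j k) U)
    (hC₂₃ : ∀ i j k, C i j k = C i k j) {x : Space n} (hx : x ∈ U) {a : Fin n → Fin n → ℝ}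
    (ha : ∀ k l i j, curvature (fun k i j y => christoffel g k i j y + hat g C k i j y) k l i j x
      = g i j x * a k l - g l j x * a k i) (j k : Fin n) :
    2 * (ricci (christoffel g) j k x
      + ∑ i, ∑ m, (hat g C i i m x * hat g C m j k x - hat g C i j m x * hat g C m i k x)) =
    g j k x * (∑ m, a m m) + ((n : ℝ) - 2) * ∑ m, g m k x * a m j := by
  have hΓ := contDiffOn_christoffel hU hg hdet
  have hD := contDiffOn_hat hg hdet hC
  -- With `L` the lowered shape operator, the two Ricci tensors `(tr A) g - L` and `(n - 1) L` add
  -- up to `(tr A) g + (n - 2) L`.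
  rw [← ricci_add_add_ricci_sub
    (fun i j k => differentiableAt_of_contDiffOn hU (hΓ i j k) hx)
    (fun i j k => differentiableAt_of_contDiffOn hU (hD i j k) hx),
    ricci_of_curvature ha, ricci_of_dual hU hg hsymm (fun i j k => (hΓ i j k).add (hD i j k))
      (fun i j k => (hΓ i j k).sub (hD i j k))
      (fun y hy => pd_metric_dual hsymm hC₂₃ (hdet y hy)) hx (hdet x hx) ha]
  ring

/-- The part of the Gauss equation odd in `C`. -/
theorem gauss_odd {U : Set (Space n)} (hU : IsOpen U) {g : Tensor2 n} {C : Tensor3 n}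
    (hg : ∀ i j, ContDiffOn ℝ ∞ (g i j) U) (hdet : ∀ x ∈ U, (mat g x).det ≠ 0)
    (hsymm : ∀ i j, g i j = g j i) (hC : ∀ i j k, ContDiffOn ℝ ∞ (C i j k) U)
    (hC₂₃ : ∀ i j k, C i j k = C i k j) (hcyc : ∀ i j k, C i j k = C j k i)
    {θ : Tensor1 n} (hθ : ∀ y ∈ U, ∀ k, ∑ i, hat g C i i k y = θ k y)
    {x : Space n} (hx : x ∈ U) {a : Fin n → Fin n → ℝ}
    (ha : ∀ k l i j, curvature (fun k i j y => christoffel g k i j y + hat g C k i j y) k l i j x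
      = g i j x * a k l - g l j x * a k i) (j k : Fin n) :
    2 * (div3 g C j k x - (pd j (θ k) x - ∑ m, christoffel g m j k x * θ m x)) =
    g j k x * (∑ m, a m m) - (n : ℝ) * ∑ m, g m k x * a m j := by
  have hΓ := contDiffOn_christoffel hU hg hdet
  have hD := contDiffOn_hat hg hdet hC
  have hd (i j k : Fin n) : DifferentiableAt ℝ (hat g C i j k) x :=
    differentiableAt_of_contDiffOn hU (hD i j k) hx
  have h := ricci_add_sub_ricci_sub
    (fun i j k => differentiableAt_of_contDiffOn hU (hΓ i j k) hx) hd j k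
  rw [ricci_of_curvature ha, ricci_of_dual hU hg hsymm (fun i j k => (hΓ i j k).add (hD i j k))
      (fun i j k => (hΓ i j k).sub (hD i j k))
      (fun y hy => pd_metric_dual hsymm hC₂₃ (hdet y hy)) hx (hdet x hx) ha] at h
  -- `θ` is the trace of `Ĉ` on all of `U`, so its derivative is the sum of the derivatives of the
  -- diagonal components appearing in `h`.
  rw [div3_eq hU hg hdet hsymm hC hcyc hx, ← pd_congr_of_eqOn hU (fun y hy => hθ y hy k) hx,
    pd_sum fun i _ => hd i i k]
  have hθx : ∑ m, christoffel g m j k x * θ m x =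
      ∑ m, ∑ i, christoffel g m j k x * hat g C i i m x := by
    simp only [← hθ x hx, Finset.mul_sum]
  rw [hθx]
  simp only [Finset.sum_add_distrib, Finset.sum_sub_distrib] at h ⊢
  rw [Finset.sum_comm (f := fun i p => christoffel g p i j x * hat g C i p k x),
    Finset.sum_comm (f := fun m i => christoffel g m j k x * hat g C i i m x)]
  simp only [fun m i : Fin n => christoffel_symm hsymm m i j, mul_comm (hat g C _ _ _ x)] at h ⊢
  linarith

/-! ### The cubic form `(1/3) (S + Sym(dt ⊗ g))` -/

theorem hessian_symm {U : Set (Space n)} (hU : IsOpen U) {g : Tensor2 n}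
    (hsymm : ∀ i j, g i j = g j i) {t : Space n → ℝ} (ht : ContDiffOn ℝ ∞ t U)
    {x : Space n} (hx : x ∈ U) (i j : Fin n) :
    hessian (christoffel g) t i j x = hessian (christoffel g) t j i x := by
  simp only [hessian, pd_comm hU ht hx i j, christoffel_symm hsymm _ i j]

/-- The cubic form `(1/3) (S(X,Y,Z) + dt(X) g(Y,Z) + dt(Y) g(X,Z) + dt(Z) g(X,Y))`. -/
noncomputable def assocCubic (g : Tensor2 n) (S : Tensor3 n) (t : Space n → ℝ) : Tensor3 n :=
  fun i j k x => 1 / 3 * (S i j k x + pd i t x * g j k x + pd j t x * g i k x + pd k t x * g i j x)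

theorem contDiffOn_assocCubic {U : Set (Space n)} (hU : IsOpen U) {g : Tensor2 n} {S : Tensor3 n}
    {t : Space n → ℝ} (hg : ∀ i j, ContDiffOn ℝ ∞ (g i j) U)
    (hS : ∀ i j k, ContDiffOn ℝ ∞ (S i j k) U) (ht : ContDiffOn ℝ ∞ t U) (i j k : Fin n) :
    ContDiffOn ℝ ∞ (assocCubic g S t i j k) U :=
  contDiffOn_const.mul ((((hS i j k).add ((contDiffOn_pd hU ht i).mul (hg j k))).add
    ((contDiffOn_pd hU ht j).mul (hg i k))).add ((contDiffOn_pd hU ht k).mul (hg i j)))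

theorem covDeriv3_assocCubic {U : Set (Space n)} (hU : IsOpen U) {g : Tensor2 n} {S : Tensor3 n}
    {t : Space n → ℝ} (hg : ∀ i j, ContDiffOn ℝ ∞ (g i j) U)
    (hdet : ∀ x ∈ U, (mat g x).det ≠ 0) (hsymm : ∀ i j, g i j = g j i)
    (hS : ∀ i j k, ContDiffOn ℝ ∞ (S i j k) U) (ht : ContDiffOn ℝ ∞ t U)
    {x : Space n} (hx : x ∈ U) (l i j k : Fin n) :
    covDeriv3 (christoffel g) (assocCubic g S t) l i j k x =
      1 / 3 * (covDeriv3 (christoffel g) S l i j k x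
        + hessian (christoffel g) t l i x * g j k x + hessian (christoffel g) t l j x * g i k x
        + hessian (christoffel g) t l k x * g i j x) := by
  have hd {h : Space n → ℝ} (hh : ContDiffOn ℝ ∞ h U) : DifferentiableAt ℝ h x :=
    differentiableAt_of_contDiffOn hU hh hx
  have d1 (i j k : Fin n) : DifferentiableAt ℝ (fun y => pd i t y * g j k y) x :=
    (hd (contDiffOn_pd hU ht i)).fun_mul (hd (hg j k))
  have e (i j k : Fin n) : pd l (fun y => pd i t y * g j k y) x = pd i t x * (∑ m,
      christoffel g m l j x * g m k x + ∑ m, christoffel g m l k x * g j m x)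
        + pd l (pd i t) x * g j k x := by
    rw [pd_mul (hd (contDiffOn_pd hU ht i)) (hd (hg j k)), pd_metric hsymm (hdet x hx)]
  have h1 : pd l (assocCubic g S t i j k) x = 1 / 3 * (pd l (S i j k) x
      + pd l (fun y => pd i t y * g j k y) x + pd l (fun y => pd j t y * g i k y) x
      + pd l (fun y => pd k t y * g i j y) x) := by
    rw [← pd_add (hd (hS i j k)) (d1 i j k),
      ← pd_add ((hd (hS i j k)).fun_add (d1 i j k)) (d1 j i k),
      ← pd_add (((hd (hS i j k)).fun_add (d1 i j k)).fun_add (d1 j i k)) (d1 k i j),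
      ← pd_const_mul _ ((((hd (hS i j k)).fun_add (d1 i j k)).fun_add (d1 j i k)).fun_add
        (d1 k i j))]
    rfl
  have h2 : ∑ m, (christoffel g m l i x * assocCubic g S t m j k x
      + christoffel g m l j x * assocCubic g S t i m k x
      + christoffel g m l k x * assocCubic g S t i j m x) =
      1 / 3 * (∑ m, (christoffel g m l i x * S m j k x + christoffel g m l j x * S i m k x
          + christoffel g m l k x * S i j m x)
        + (∑ m, christoffel g m l i x * pd m t x) * g j k x
        + (∑ m, christoffel g m l j x * pd m t x) * g i k x
        + (∑ m, christoffel g m l k x * pd m t x) * g i j x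
        + pd i t x * (∑ m, christoffel g m l j x * g m k x + ∑ m, christoffel g m l k x * g j m x)
        + pd j t x * (∑ m, christoffel g m l i x * g m k x + ∑ m, christoffel g m l k x * g i m x)
        + pd k t x *
          (∑ m, christoffel g m l i x * g m j x + ∑ m, christoffel g m l j x * g i m x)) := by
    simp only [Finset.mul_sum, Finset.sum_mul, ← Finset.sum_add_distrib, assocCubic]
    exact Finset.sum_congr rfl fun m _ => by ring
  rw [covDeriv3, h1, e, e, e, h2]
  simp only [covDeriv3, hessian]
  ring

theorem div3_assocCubic {U : Set (Space n)} (hU : IsOpen U) {g : Tensor2 n} {S : Tensor3 n}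
    {t : Space n → ℝ} (hg : ∀ i j, ContDiffOn ℝ ∞ (g i j) U)
    (hdet : ∀ x ∈ U, (mat g x).det ≠ 0) (hsymm : ∀ i j, g i j = g j i)
    (hS : ∀ i j k, ContDiffOn ℝ ∞ (S i j k) U) (ht : ContDiffOn ℝ ∞ t U)
    {x : Space n} (hx : x ∈ U) (j k : Fin n) :
    div3 g (assocCubic g S t) j k x = 1 / 3 * (div3 g S j k x
      + 2 * hessian (christoffel g) t j k x
      + trace g (hessian (christoffel g) t) x * g j k x) := by
  have h1 (v : Fin n → ℝ) (k : Fin n) : ∑ a, ∑ b, inv g a b x * (v a * g b k x) = v k := by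
    have := fun a => inv_mul_metric (hdet x hx) a k
    simp only [mul_left_comm (inv g _ _ x), ← Finset.mul_sum, this]
    simp
  have h2 := h1 (fun a => hessian (christoffel g) t a j x) k
  have h3 := h1 (fun a => hessian (christoffel g) t a k x) j
  simp only [div3, covDeriv3_assocCubic hU hg hdet hsymm hS ht hx, trace]
  have h4 : ∑ a, ∑ b, inv g a b x * (1 / 3 * (covDeriv3 (christoffel g) S a b j k x
        + hessian (christoffel g) t a b x * g j k x + hessian (christoffel g) t a j x * g b k x
        + hessian (christoffel g) t a k x * g b j x)) =
      1 / 3 * (∑ a, ∑ b, inv g a b x * covDeriv3 (christoffel g) S a b j k x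
        + (∑ a, ∑ b, inv g a b x * hessian (christoffel g) t a b x) * g j k x
        + ∑ a, ∑ b, inv g a b x * (hessian (christoffel g) t a j x * g b k x)
        + ∑ a, ∑ b, inv g a b x * (hessian (christoffel g) t a k x * g b j x)) := by
    simp only [Finset.mul_sum, Finset.sum_mul, ← Finset.sum_add_distrib]
    exact Finset.sum_congr rfl fun _ _ => Finset.sum_congr rfl fun _ _ => by ring
  rw [h4, h2, h3, hessian_symm hU hsymm ht hx k j]
  ring

/-! ### Contractions of the associated cubic form at a point -/

/-- The vector field dual to a 1-form. -/
noncomputable def sharp (g : Tensor2 n) (u : Tensor1 n) : Tensor1 n :=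
    fun k x => ∑ l, inv g k l x * u l x

section Pointwise

variable {g : Tensor2 n} {S : Tensor3 n} {t : Space n → ℝ} {x : Space n}

theorem metric_mul_sharp (hdet : (mat g x).det ≠ 0) (u : Tensor1 n) (k : Fin n) :
    ∑ m, g k m x * sharp g u m x = u k x :=
  metric_mul_inv_apply hdet (fun l => u l x) k

theorem sum_mul_sharp (u v : Tensor1 n) :
    ∑ m, u m x * sharp g v m x = inner1 g u v x := by
  simp only [sharp, inner1, Finset.mul_sum]
  exact Finset.sum_congr rfl fun _ _ => Finset.sum_congr rfl fun _ _ => by ring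

theorem sum_cubic_mul_sharp (u : Tensor1 n) (i j : Fin n) :
    ∑ k, S i j k x * sharp g u k x = contract1 g S u i j x := by
  simp only [sharp, contract1, Finset.mul_sum]
  exact Finset.sum_congr rfl fun _ _ => Finset.sum_congr rfl fun _ _ => by ring

theorem sum_mul_hat (hsymm : ∀ i j, g i j = g j i) (u : Tensor1 n) (i j : Fin n) :
    ∑ k, u k x * hat g S k i j x = contract1 g S u i j x := by
  simp only [hat, contract1, Finset.mul_sum]
  rw [Finset.sum_comm]
  refine Finset.sum_congr rfl fun k _ => Finset.sum_congr rfl fun l _ => ?_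
  rw [inv_symm hsymm k l]
  ring

theorem hat_symm (hS₁₂ : ∀ i j k, S i j k = S j i k) (k i j : Fin n) :
    hat g S k i j x = hat g S k j i x := by
  simp only [hat, hS₁₂ i j]

theorem sum_hat_eq_zero (hS₂₃ : ∀ i j k, S i j k = S i k j)
    (htr : ∀ k, trace g (fun i j => S i j k) x = 0) (k : Fin n) : ∑ i, hat g S i i k x = 0 := by
  simpa only [hat, trace, hS₂₃ _ k] using htr k

theorem hat_assocCubic (hsymm : ∀ i j, g i j = g j i) (hdet : (mat g x).det ≠ 0) (k i j : Fin n) :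
    hat g (assocCubic g S t) k i j x = 1 / 3 * (hat g S k i j x
      + pd i t x * (if k = j then 1 else 0) + pd j t x * (if k = i then 1 else 0)
      + sharp g (differential t) k x * g i j x) := by
  have h1 : ∑ l, inv g k l x * g i l x = if k = i then 1 else 0 := by
    rw [← inv_mul_metric hdet k i]
    exact Finset.sum_congr rfl fun l _ => by rw [hsymm i l]
  have h2 : ∑ l, inv g k l x * g j l x = if k = j then 1 else 0 := by
    rw [← inv_mul_metric hdet k j]
    exact Finset.sum_congr rfl fun l _ => by rw [hsymm j l]
  rw [← h1, ← h2]
  simp only [hat, assocCubic, sharp, differential, Finset.mul_sum, Finset.sum_mul,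
    ← Finset.sum_add_distrib]
  exact Finset.sum_congr rfl fun l _ => by ring

theorem trace_metric (hsymm : ∀ i j, g i j = g j i) (hdet : (mat g x).det ≠ 0) :
    trace g g x = n := by
  have h (i : Fin n) : ∑ j, inv g i j x * g i j x = 1 := by
    have h' := inv_mul_metric hdet i i
    simp only [fun k : Fin n => hsymm k i, if_true] at h'
    exact h'
  simp [trace, h]

/-- `S` contributes nothing, being trace-free. Of the three `dt`-terms one traces the identity and
gives `n`, the other two give `1` each. -/
theorem sum_hat_assocCubic (hsymm : ∀ i j, g i j = g j i) (hdet : (mat g x).det ≠ 0)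
    (hS₂₃ : ∀ i j k, S i j k = S i k j)
    (htr : ∀ k, trace g (fun i j => S i j k) x = 0) (k : Fin n) :
    ∑ i, hat g (assocCubic g S t) i i k x = ((n : ℝ) + 2) / 3 * pd k t x := by
  have h := metric_mul_sharp hdet (differential t) k
  simp only [hat_assocCubic hsymm hdet, ← Finset.mul_sum, Finset.sum_add_distrib,
    sum_hat_eq_zero hS₂₃ htr, hsymm _ k, mul_comm (sharp g _ _ x), h]
  simp [differential]
  ring

theorem sum_hat_assocCubic_mul (hsymm : ∀ i j, g i j = g j i) (hdet : (mat g x).det ≠ 0)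
    (v : Fin n → ℝ) (i j : Fin n) :
    ∑ m, hat g (assocCubic g S t) i j m x * v m = 1 / 3 * (∑ m, hat g S i j m x * v m
      + pd j t x * v i + (if i = j then 1 else 0) * (∑ m, pd m t x * v m)
      + sharp g (differential t) i x * ∑ m, g j m x * v m) := by
  have h : pd j t x * v i = ∑ m, pd j t x * (if i = m then 1 else 0) * v m := by simp
  rw [h]
  simp only [hat_assocCubic hsymm hdet, Finset.mul_sum, ← Finset.sum_add_distrib]
  exact Finset.sum_congr rfl fun m _ => by ring

theorem sum_pd_mul_hat_assocCubic (hsymm : ∀ i j, g i j = g j i) (hdet : (mat g x).det ≠ 0)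
    (j k : Fin n) :
    ∑ m, pd m t x * hat g (assocCubic g S t) m j k x = 1 / 3 *
      (contract1 g S (differential t) j k x + 2 * (pd j t x * pd k t x)
        + inner1 g (differential t) (differential t) x * g j k x) := by
  have h1 := sum_mul_hat (x := x) (S := S) hsymm (differential t) j k
  have h2 := sum_mul_sharp (x := x) (g := g) (differential t) (differential t)
  have h3 (i : Fin n) : pd i t x = ∑ m, pd m t x * (if m = i then 1 else 0) := by simp
  rw [← h1, ← h2]
  have h4 : 2 * (pd j t x * pd k t x) = pd j t x * (∑ m, pd m t x * (if m = k then 1 else 0))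
      + pd k t x * ∑ m, pd m t x * (if m = j then 1 else 0) := by
    rw [← h3, ← h3]
    ring
  rw [h4]
  simp only [hat_assocCubic hsymm hdet, differential, Finset.mul_sum, Finset.sum_mul,
    ← Finset.sum_add_distrib]
  exact Finset.sum_congr rfl fun m _ => by ring

/-- The expression is the trace form of `Ĉ` applied to `Ĉ(∂ⱼ, ∂ₖ)`, minus `tr(C_j C_k)`. The first
part is `h1`; the second is `h4`, obtained by expanding one factor, with `h3` and `h2` for its `S`-
and gradient terms. -/
theorem quadratic_assocCubic (hsymm : ∀ i j, g i j = g j i) (hdet : (mat g x).det ≠ 0)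
    (hS₁₂ : ∀ i j k, S i j k = S j i k) (hS₂₃ : ∀ i j k, S i j k = S i k j)
    (htr : ∀ k, trace g (fun i j => S i j k) x = 0) (j k : Fin n) :
    ∑ i, ∑ m, (hat g (assocCubic g S t) i i m x * hat g (assocCubic g S t) m j k x
      - hat g (assocCubic g S t) i j m x * hat g (assocCubic g S t) m i k x) =
    1 / 9 * (((n : ℝ) - 2) *
        (contract1 g S (differential t) j k x + pd j t x * pd k t x)
      + (n : ℝ) * inner1 g (differential t) (differential t) x * g j k x
      - trProd g S j k x) := by
  have hcs (i j : Fin n) : contract1 g S (differential t) i j x =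
      contract1 g S (differential t) j i x := by simp only [contract1, hS₁₂ i j]
  have h1 : ∑ i, ∑ m, hat g (assocCubic g S t) i i m x * hat g (assocCubic g S t) m j k x =
      ((n : ℝ) + 2) / 9 *
      (contract1 g S (differential t) j k x + 2 * (pd j t x * pd k t x)
          + inner1 g (differential t) (differential t) x * g j k x) := by
    rw [Finset.sum_comm]
    simp only [← Finset.sum_mul, sum_hat_assocCubic hsymm hdet hS₂₃ htr, mul_assoc,
      ← Finset.mul_sum, sum_pd_mul_hat_assocCubic hsymm hdet]
    ring
  have hlow (i : Fin n) : ∑ m, g j m x * hat g (assocCubic g S t) m i k x = 1 / 3 * (S i k j x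
      + pd i t x * g k j x
      + pd k t x * g i j x + pd j t x * g i k x) := metric_mul_hat hdet _ _ _ _
  have h2 : ∑ i, sharp g (differential t) i x * ∑ m, g j m x * hat g (assocCubic g S t) m i k x =
      1 / 3 * (contract1 g S (differential t) j k x
          + inner1 g (differential t) (differential t) x * g j k x
          + 2 * (pd j t x * pd k t x)) := by
    have e1 := sum_cubic_mul_sharp (g := g) (S := S) (x := x) (differential t) k j
    have e2 := sum_mul_sharp (x := x) (g := g) (differential t) (differential t)
    have e3 := metric_mul_sharp hdet (differential t) j
    have e4 := metric_mul_sharp hdet (differential t) k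
    have e5 : 2 * (pd j t x * pd k t x) = pd k t x * differential t j x
      + pd j t x * differential t k x := by simp only [differential]; ring
    rw [hcs j k, e5, ← e1, ← e2, ← e3, ← e4]
    simp only [hlow, differential, Finset.mul_sum, Finset.sum_mul, ← Finset.sum_add_distrib]
    refine Finset.sum_congr rfl fun i _ => ?_
    rw [hS₁₂ i k, hS₂₃ k i, hsymm k j, hsymm i j, hsymm i k]
    ring
  have h3 : ∑ i, ∑ m, hat g S i j m x * hat g (assocCubic g S t) m i k x =
      1 / 3 * (trProd g S j k x + 2 * contract1 g S (differential t) j k x) := by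
    have e1 := sum_mul_hat (x := x) (S := S) hsymm (differential t) j k
    have e2 : ∑ i, ∑ m, hat g S i j m x * hat g S m i k x = trProd g S j k x := by
      simp only [trProd, hat_symm hS₁₂ _ k]
    have e3 := sum_hat_eq_zero hS₂₃ htr j
    have e4 : ∑ i, ∑ m, hat g S i j m x * (sharp g (differential t) m x * g i k x) =
        contract1 g S (differential t) j k x := by
      rw [← sum_cubic_mul_sharp, Finset.sum_comm]
      refine Finset.sum_congr rfl fun m _ => ?_
      rw [hS₂₃ j k m, ← metric_mul_hat hdet S j m k, Finset.sum_mul]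
      refine Finset.sum_congr rfl fun i _ => ?_
      rw [hsymm i k]
      ring
    have e5 : ∑ i, ∑ m, hat g S i j m x * (pd i t x * (if m = k then 1 else 0)) =
        contract1 g S (differential t) j k x := by
      rw [← e1]
      simp [differential, mul_comm]
    have e6 : ∑ i, ∑ m, hat g S i j m x * (pd k t x * (if m = i then 1 else 0)) = 0 := by
      have : ∑ i, hat g S i j i x = 0 := by simpa only [hat_symm hS₁₂ _ j] using e3
      simp [← Finset.sum_mul, this]
    have e7 : ∑ i, ∑ m, hat g S i j m x * hat g (assocCubic g S t) m i k x =
        1 / 3 * (∑ i, ∑ m, hat g S i j m x * hat g S m i k x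
          + ∑ i, ∑ m, hat g S i j m x * (pd i t x * (if m = k then 1 else 0))
          + ∑ i, ∑ m, hat g S i j m x * (pd k t x * (if m = i then 1 else 0))
          + ∑ i, ∑ m, hat g S i j m x * (sharp g (differential t) m x * g i k x)) := by
      simp only [hat_assocCubic hsymm hdet, Finset.mul_sum, ← Finset.sum_add_distrib]
      exact Finset.sum_congr rfl fun _ _ => Finset.sum_congr rfl fun _ _ => by ring
    rw [e7, e2, e5, e6, e4]
    ring
  have h4 : ∑ i, ∑ m, hat g (assocCubic g S t) i j m x * hat g (assocCubic g S t) m i k x =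
      1 / 9 * (trProd g S j k x + 4 * contract1 g S (differential t) j k x
      + ((n : ℝ) + 6) * (pd j t x * pd k t x)
          + 2 * (inner1 g (differential t) (differential t) x * g j k x)) := by
    have hs (i : Fin n) : ∑ m, hat g (assocCubic g S t) i j m x * hat g (assocCubic g S t) m i k x = _ :=
      sum_hat_assocCubic_mul hsymm hdet (fun m => hat g (assocCubic g S t) m i k x) i j
    simp only [hs, ← Finset.mul_sum, Finset.sum_add_distrib, h3, h2]
    simp only [ite_mul, one_mul, zero_mul, Finset.sum_ite_eq', Finset.mem_univ, if_true]
    rw [sum_pd_mul_hat_assocCubic hsymm hdet, sum_hat_assocCubic hsymm hdet hS₂₃ htr]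
    ring
  simp only [Finset.sum_sub_distrib]
  rw [h1, h4]
  ring

theorem trace_trProd (hsymm : ∀ i j, g i j = g j i) (hS₂₃ : ∀ i j k, S i j k = S i k j) :
    trace g (trProd g S) x = normSq3 g S x := by
  simp only [trace, normSq3]
  refine Finset.sum_congr rfl fun i _ => ?_
  rw [Finset.sum_comm_cycle]
  refine Finset.sum_congr rfl fun a _ => ?_
  rw [trProd, Finset.sum_comm, Finset.mul_sum]
  refine Finset.sum_congr rfl fun j _ => ?_
  rw [Finset.sum_comm_cycle, Finset.mul_sum]
  refine Finset.sum_congr rfl fun c _ => ?_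
  rw [hat, hat, Finset.sum_mul_sum, Finset.mul_sum]
  refine Finset.sum_congr rfl fun k _ => ?_
  rw [Finset.mul_sum]
  refine Finset.sum_congr rfl fun b _ => ?_
  rw [inv_symm hsymm c k, hS₂₃ a c b]
  ring

theorem trace_contract1 (htr : ∀ k, trace g (fun i j => S i j k) x = 0) (u : Tensor1 n) :
    trace g (contract1 g S u) x = 0 := by
  have h : trace g (contract1 g S u) x =
      ∑ k, sharp g u k x * trace g (fun i j => S i j k) x := by
    simp only [trace, ← sum_cubic_mul_sharp, Finset.mul_sum]
    rw [Finset.sum_comm_cycle]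
    exact Finset.sum_congr rfl fun _ _ => Finset.sum_congr rfl fun _ _ =>
      Finset.sum_congr rfl fun _ _ => by ring
  simp [h, htr]

end Pointwise

/-! ### Adapted frames -/

section Frame

variable {f ξ : Space n → EuclideanSpace ℝ (Fin (n + 1))} {x : Space n}

theorem adaptedFrame_mulVec (c : Fin (n + 1) → ℝ) :
    (adaptedFrame f ξ x).mulVec c =
      fun a => (∑ k : Fin n, c k.castSucc • pd k f x + c (Fin.last n) • ξ x) a := by
  funext a
  simp [Matrix.mulVec, dotProduct, adaptedFrame, Fin.sum_univ_castSucc, mul_comm]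

theorem eq_sum_frameCoeff (hdet : (adaptedFrame f ξ x).det ≠ 0)
    (w : EuclideanSpace ℝ (Fin (n + 1))) :
    w = ∑ k : Fin n, frameCoeff f ξ x w k.castSucc • pd k f x
      + frameCoeff f ξ x w (Fin.last n) • ξ x := by
  have h := adaptedFrame_mulVec (f := f) (ξ := ξ) (x := x) (frameCoeff f ξ x w)
  rw [frameCoeff, Matrix.mulVec_mulVec, Matrix.mul_nonsing_inv _ hdet.isUnit,
    Matrix.one_mulVec] at h
  ext a
  exact congrFun h a

theorem eq_zero_of_frame_sum_eq_zero (hdet : (adaptedFrame f ξ x).det ≠ 0) (c : Fin n → ℝ) (d : ℝ)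
    (h : ∑ k, c k • pd k f x + d • ξ x = 0) (k : Fin n) : c k = 0 := by
  have h1 : (adaptedFrame f ξ x).mulVec (Fin.snoc (α := fun _ => ℝ) c d) = 0 := by
    rw [adaptedFrame_mulVec]
    funext a
    simp only [Fin.snoc_castSucc, Fin.snoc_last, h]
    rfl
  have h2 := Matrix.eq_zero_of_mulVec_eq_zero hdet h1
  simpa using congrFun h2 k.castSucc

/-- The inverse of a singular matrix is zero by convention, so a degenerate frame would make all
frame coefficients, and with them `G`, vanish. For `n > 0` the zero matrix has determinant zero,
contradicting non-degeneracy. -/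
theorem adaptedFrame_det_ne_zero (hn : 0 < n)
    (hG : (Matrix.of fun i j => fundamentalForm f ξ i j x).det ≠ 0) :
    (adaptedFrame f ξ x).det ≠ 0 := by
  intro h
  have : Nonempty (Fin n) := ⟨⟨0, hn⟩⟩
  have hinv : (adaptedFrame f ξ x)⁻¹ = 0 := Matrix.nonsing_inv_apply_not_isUnit _ (by simp [h])
  apply hG
  have h0 : (Matrix.of fun i j => fundamentalForm f ξ i j x) = 0 := by
    ext i j
    simp [fundamentalForm, frameCoeff, hinv]
  rw [h0, Matrix.det_zero]

end Frame

/-! ### The normalisation associated to `(g, S, t)`, in a coordinate domain -/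

/-- `f` with transversal field `ξ` is a relative normalisation with metric `g` and cubic
`(1/3) (S + Sym(dt ⊗ g))` in the coordinate domain `U`. -/
structure IsAssociatedOn (U : Set (Space n)) (g : Tensor2 n) (S : Tensor3 n) (t : Space n → ℝ)
    (f ξ : Space n → EuclideanSpace ℝ (Fin (n + 1))) : Prop where
  isOpen : IsOpen U
  smooth_g : ∀ i j, ContDiffOn ℝ ∞ (g i j) U
  smooth_S : ∀ i j k, ContDiffOn ℝ ∞ (S i j k) U
  smooth_t : ContDiffOn ℝ ∞ t U
  smooth_f : ContDiffOn ℝ ∞ f U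
  smooth_ξ : ContDiffOn ℝ ∞ ξ U
  g_symm : ∀ i j, g i j = g j i
  S_symm₁₂ : ∀ i j k, S i j k = S j i k
  S_symm₂₃ : ∀ i j k, S i j k = S i k j
  S_traceFree : ∀ x ∈ U, ∀ k, trace g (fun i j => S i j k) x = 0
  det_ne_zero : ∀ x ∈ U, (mat g x).det ≠ 0
  frame_det_ne_zero : ∀ x ∈ U, (adaptedFrame f ξ x).det ≠ 0
  relative : ∀ x ∈ U, ∀ i, normalForm f ξ i x = 0
  metric_eq : ∀ x ∈ U, ∀ i j, fundamentalForm f ξ i j x = g i j x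
  cubic_eq : ∀ x ∈ U, ∀ i j k, cubic f ξ i j k x = assocCubic g S t i j k x

/-- The shape operator: `∂ᵢξ = -∑ₖ shape k i ∂ₖf` for a relative normalisation. -/
noncomputable def shape (f ξ : Space n → EuclideanSpace ℝ (Fin (n
    + 1))) (x : Space n) (k i : Fin n) : ℝ :=
  -frameCoeff f ξ x (pd i ξ x) k.castSucc

/-- The tensor whose vanishing is the even part of the Gauss equation for the shape operator
zero. -/
noncomputable def gaussTensor (g : Tensor2 n) (S : Tensor3 n) (t : Space n → ℝ) : Tensor2 n :=
    fun j k x =>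
  9 * ricci (christoffel g) j k x
    + ((n : ℝ) - 2) * (contract1 g S (differential t) j k x + pd j t x * pd k t x)
    + (n : ℝ) * inner1 g (differential t) (differential t) x * g j k x
    - trProd g S j k x

namespace IsAssociatedOn

variable {U : Set (Space n)} {g : Tensor2 n} {S : Tensor3 n} {t : Space n → ℝ}
  {f ξ : Space n → EuclideanSpace ℝ (Fin (n + 1))} {x : Space n}

theorem pd_eq_shape (h : IsAssociatedOn U g S t f ξ) (hx : x ∈ U) (i : Fin n) :
    pd i ξ x = -∑ k, shape f ξ x k i • pd k f x := by
  have h1 := eq_sum_frameCoeff (h.frame_det_ne_zero x hx) (pd i ξ x)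
  have h2 : frameCoeff f ξ x (pd i ξ x) (Fin.last n) = 0 := h.relative x hx i
  rw [h2, zero_smul, add_zero] at h1
  simpa [shape] using h1

theorem pd_eq_zero_iff (h : IsAssociatedOn U g S t f ξ) (hx : x ∈ U) :
    (∀ i, pd i ξ x = 0) ↔ ∀ k i, shape f ξ x k i = 0 := by
  constructor
  · intro h0 k i
    refine eq_zero_of_frame_sum_eq_zero (h.frame_det_ne_zero x hx)
      (fun k => shape f ξ x k i) 0 ?_ k
    have := h.pd_eq_shape hx i
    rw [h0 i] at this
    simpa using this.symm
  · intro h0 i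
    simp [h.pd_eq_shape hx, h0]

theorem cubic_symm₂₃ (h : IsAssociatedOn U g S t f ξ) (i j k : Fin n) :
    assocCubic g S t i j k = assocCubic g S t i k j := by
  funext y
  simp only [assocCubic, h.S_symm₂₃ i j k, h.g_symm j k]
  ring

theorem cubic_cyc (h : IsAssociatedOn U g S t f ξ) (i j k : Fin n) :
    assocCubic g S t i j k = assocCubic g S t j k i := by
  funext y
  simp only [assocCubic, h.S_symm₁₂ i j k, h.S_symm₂₃ j i k, h.g_symm j i, h.g_symm k i]
  ring

theorem inducedConnection_eq (h : IsAssociatedOn U g S t f ξ) (hx : x ∈ U) (k i j : Fin n) :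
    inducedConnection f ξ k i j x =
      christoffel g k i j x + hat g (assocCubic g S t) k i j x := by
  have h1 (b c : Fin n) : fundamentalForm f ξ b c x = g b c x := h.metric_eq x hx b c
  -- Christoffel symbols involve first derivatives, so agreement of `G` and `g` on the open set `U`
  -- is used here, not only at `x`.
  have h2 (k i j : Fin n) : christoffel (fundamentalForm f ξ) k i j x = christoffel g k i j x := by
    have hp (l b c : Fin n) : pd l (fundamentalForm f ξ b c) x = pd l (g b c) x :=
      pd_congr_of_eqOn h.isOpen (fun y hy => h.metric_eq y hy b c) hx l
    simp only [christoffel, inv, h1, hp]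
  have h4 := inv_mul_metric_apply (h.det_ne_zero x hx)
    (fun l => inducedConnection f ξ l i j x - christoffel g l i j x) k
  have h5 : ∀ m, ∑ l, g m l x * (inducedConnection f ξ l i j x - christoffel g l i j x) =
      assocCubic g S t i j m x := fun m => by
    rw [← h.cubic_eq x hx i j m, cubic]
    exact Finset.sum_congr rfl fun l _ => by rw [h1, h2, h.g_symm]
  simp only [h5] at h4
  rw [hat, h4]
  ring

theorem structure_eq (h : IsAssociatedOn U g S t f ξ) (hx : x ∈ U) (i j : Fin n) :
    pd i (pd j f) x = ∑ k, inducedConnection f ξ k i j x • pd k f x + g i j x • ξ x := by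
  rw [← h.metric_eq x hx]
  exact eq_sum_frameCoeff (h.frame_det_ne_zero x hx) (pd i (pd j f) x)

theorem curvature_eq (h : IsAssociatedOn U g S t f ξ) (hx : x ∈ U) (k l i j : Fin n) :
    curvature (fun k i j y => christoffel g k i j y + hat g (assocCubic g S t) k i j y) k l i j x =
      g i j x * shape f ξ x k l - g l j x * shape f ξ x k i := by
  have hC := contDiffOn_assocCubic h.isOpen h.smooth_g h.smooth_S h.smooth_t
  refine curvature_eq_of_structure h.isOpen h.smooth_f h.smooth_ξ
    (fun i j k => (contDiffOn_christoffel h.isOpen h.smooth_g h.det_ne_zero i j k).add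
      (contDiffOn_hat h.smooth_g h.det_ne_zero hC i j k)) h.smooth_g (fun y hy i j => ?_) hx
    (h.pd_eq_shape hx) (eq_zero_of_frame_sum_eq_zero (h.frame_det_ne_zero x hx)) k l i j
  simp only [h.structure_eq hy, h.inducedConnection_eq hy]

theorem gaussTensor_eq (h : IsAssociatedOn U g S t f ξ) (hx : x ∈ U) (j k : Fin n) :
    2 / 9 * gaussTensor g S t j k x = g j k x * (∑ m, shape f ξ x m m)
      + ((n : ℝ) - 2) * ∑ m, g m k x * shape f ξ x m j := by
  rw [← gauss_even h.isOpen h.smooth_g h.det_ne_zero h.g_symm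
    (contDiffOn_assocCubic h.isOpen h.smooth_g h.smooth_S h.smooth_t) h.cubic_symm₂₃ hx
    (h.curvature_eq hx),
    quadratic_assocCubic h.g_symm (h.det_ne_zero x hx) h.S_symm₁₂ h.S_symm₂₃ (h.S_traceFree x hx),
    gaussTensor]
  ring

/-- The odd Gauss equation with `tr C = ((n + 2)/3) dt`. The divergence of `C` contains `2/3` of the
Hessian, which leaves the coefficient `-n/3`. -/
theorem div3_sub_hessian_eq (h : IsAssociatedOn U g S t f ξ) (hx : x ∈ U) (j k : Fin n) :
    2 / 3 * (div3 g S j k x - (n : ℝ) * hessian (christoffel g) t j k x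
      + trace g (hessian (christoffel g) t) x * g j k x) =
    g j k x * (∑ m, shape f ξ x m m) - (n : ℝ) * ∑ m, g m k x * shape f ξ x m j := by
  rw [← gauss_odd h.isOpen h.smooth_g h.det_ne_zero h.g_symm
    (contDiffOn_assocCubic h.isOpen h.smooth_g h.smooth_S h.smooth_t) h.cubic_symm₂₃ h.cubic_cyc
    (θ := fun k y => ((n : ℝ) + 2) / 3 * pd k t y)
    (fun y hy => sum_hat_assocCubic h.g_symm (h.det_ne_zero y hy) h.S_symm₂₃
      (h.S_traceFree y hy)) hx (h.curvature_eq hx),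
    div3_assocCubic h.isOpen h.smooth_g h.det_ne_zero h.g_symm h.smooth_S h.smooth_t hx,
    pd_const_mul _ (differentiableAt_of_contDiffOn h.isOpen
      (contDiffOn_pd h.isOpen h.smooth_t k) hx)]
  simp only [mul_left_comm (christoffel g _ _ _ x), ← Finset.mul_sum]
  rw [hessian]
  ring

theorem trace_lowered_shape (h : IsAssociatedOn U g S t f ξ) (hx : x ∈ U)
    (a : Fin n → Fin n → ℝ) :
    ∑ j, ∑ k, inv g j k x * ∑ m, g m k x * a m j = ∑ m, a m m := by
  refine Finset.sum_congr rfl fun j _ => ?_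
  have := inv_mul_metric_apply (h.det_ne_zero x hx) (fun m => a m j) j
  simpa only [fun m k : Fin n => h.g_symm k m] using this

theorem shape_eq_zero_iff (h : IsAssociatedOn U g S t f ξ) (hx : x ∈ U) :
    (∀ k i, shape f ξ x k i = 0) ↔ ∀ j k, ∑ m, g m k x * shape f ξ x m j = 0 := by
  constructor
  · intro h0
    simp [h0]
  · intro h0 k j
    have := inv_mul_metric_apply (h.det_ne_zero x hx) (fun m => shape f ξ x m j) k
    rw [← this]
    have h1 (l : Fin n) : ∑ m, g l m x * shape f ξ x m j = 0 := by
      rw [← h0 j l]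
      exact Finset.sum_congr rfl fun m _ => by rw [h.g_symm]
    simp [h1]

theorem trace_metric_eq (h : IsAssociatedOn U g S t f ξ) (hx : x ∈ U) :
    ∑ j, ∑ k, inv g j k x * g j k x = (n : ℝ) :=
  trace_metric h.g_symm (h.det_ne_zero x hx)

theorem trace_gaussTensor (h : IsAssociatedOn U g S t f ξ) (hx : x ∈ U) :
    trace g (gaussTensor g S t) x = 9 * scal g x
      + ((n : ℝ) - 1) * ((n : ℝ) + 2) * inner1 g (differential t) (differential t) x
      - normSq3 g S x := by
  have h1 := trace_contract1 (h.S_traceFree x hx) (differential t)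
  have h2 := trace_trProd (x := x) h.g_symm h.S_symm₂₃
  have h3 := h.trace_metric_eq hx
  have h4 : ∑ i, ∑ j, inv g i j x * (pd i t x * pd j t x) =
      inner1 g (differential t) (differential t) x := by
    simp only [inner1, differential, mul_assoc]
  have h5 : trace g (gaussTensor g S t) x = 9 * trace g (ricci (christoffel g)) x
      + ((n : ℝ) - 2) * (trace g (contract1 g S (differential t)) x
        + ∑ i, ∑ j, inv g i j x * (pd i t x * pd j t x))
      + (n : ℝ) * inner1 g (differential t) (differential t) x *
        (∑ j, ∑ k, inv g j k x * g j k x) - trace g (trProd g S) x := by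
    simp only [trace, gaussTensor, Finset.mul_sum, ← Finset.sum_add_distrib,
      ← Finset.sum_sub_distrib]
    exact Finset.sum_congr rfl fun _ _ => Finset.sum_congr rfl fun _ _ => by ring
  rw [h5, h1, h2, h3, h4, scal]
  ring

theorem trace_gaussTensor_eq (h : IsAssociatedOn U g S t f ξ) (hx : x ∈ U) :
    trace g (gaussTensor g S t) x = 9 * ((n : ℝ) - 1) * ∑ m, shape f ξ x m m := by
  have h1 (j k : Fin n) : gaussTensor g S t j k x = 9 / 2 * (g j k x * (∑ m, shape f ξ x m m)
      + ((n : ℝ) - 2) * ∑ m, g m k x * shape f ξ x m j) := by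
    linarith [h.gaussTensor_eq hx j k]
  have h2 : trace g (gaussTensor g S t) x = 9 / 2 *
      ((∑ j, ∑ k, inv g j k x * g j k x) * (∑ m, shape f ξ x m m)
      + ((n : ℝ) - 2) * ∑ j, ∑ k, inv g j k x * ∑ m, g m k x * shape f ξ x m j) := by
    -- The inner contraction is made opaque, so that distributing over the outer double sum leaves
    -- it intact.
    obtain ⟨L, hL⟩ : ∃ L : Fin n → Fin n → ℝ, ∀ j k, ∑ m, g m k x * shape f ξ x m j = L j k :=
      ⟨_, fun _ _ => rfl⟩
    simp only [trace, h1, hL]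
    generalize (∑ m, shape f ξ x m m) = A
    simp only [Finset.mul_sum, Finset.sum_mul, ← Finset.sum_add_distrib]
    exact Finset.sum_congr rfl fun _ _ => Finset.sum_congr rfl fun _ _ => by ring
  rw [h2, h.trace_metric_eq hx, h.trace_lowered_shape hx]
  ring

/-! ### The shape operator in dimension at least three -/

theorem shape_eq_zero_iff_gaussTensor (h : IsAssociatedOn U g S t f ξ) (hx : x ∈ U) (hn : 3 ≤ n) :
    (∀ k i, shape f ξ x k i = 0) ↔ ∀ j k, gaussTensor g S t j k x = 0 := by
  have hn' : (3 : ℝ) ≤ n := by exact_mod_cast hn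
  constructor
  · intro h0 j k
    have := h.gaussTensor_eq hx j k
    simpa [h0] using this
  · intro h0
    have h1 := h.trace_gaussTensor_eq hx
    have h2 : trace g (gaussTensor g S t) x = 0 := by simp [trace, h0]
    -- The trace of the even equation has coefficient `9 (n - 1) ≠ 0` and removes `tr A`; what is
    -- left is `(n - 2) L = 0`, where `n ≥ 3` enters.
    have h3 : ∑ m, shape f ξ x m m = 0 := by
      rw [h2] at h1
      have : (9 : ℝ) * ((n : ℝ) - 1) ≠ 0 := by
        have : (0 : ℝ) < (n : ℝ) - 1 := by linarith
        positivity
      exact (mul_eq_zero.1 h1.symm).resolve_left this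
    rw [h.shape_eq_zero_iff hx]
    intro j k
    have h4 := h.gaussTensor_eq hx j k
    rw [h0, h3, mul_zero, mul_zero, zero_add] at h4
    exact (mul_eq_zero.1 h4.symm).resolve_left (by linarith)

theorem traceFree_schouten (h : IsAssociatedOn U g S t f ξ) (hx : x ∈ U) (hn : 3 ≤ n)
    (i j : Fin n) : traceFree g (schouten g) i j x =
      1 / ((n : ℝ) - 2) * (ricci (christoffel g) i j x - 1 / (n : ℝ) * scal g x * g i j x) := by
  have hn' : (3 : ℝ) ≤ n := by exact_mod_cast hn
  have h0 : (n : ℝ) ≠ 0 := by linarith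
  have h1 : trace g (schouten g) x = 1 / ((n : ℝ) - 2) * (trace g (ricci (christoffel g)) x
      - scal g x / (2 * ((n : ℝ) - 1)) * ∑ j, ∑ k, inv g j k x * g j k x) := by
    simp only [trace, schouten, Finset.mul_sum, ← Finset.sum_sub_distrib]
    exact Finset.sum_congr rfl fun _ _ => Finset.sum_congr rfl fun _ _ => by ring
  rw [traceFree, h1, h.trace_metric_eq hx, ← scal, schouten]
  field_simp
  ring

theorem gaussTensor_eq_zero_iff (h : IsAssociatedOn U g S t f ξ) (hx : x ∈ U) (hn : 3 ≤ n) :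
    (∀ j k, gaussTensor g S t j k x = 0) ↔
      (∀ i j, traceFree g (schouten g) i j x = 1 / 8 * tau g S t i j x) ∧
      scal g x = 1 / 9 * (normSq3 g S x - ((n : ℝ) - 1) * ((n : ℝ) + 2) *
        inner1 g (differential t) (differential t) x) := by
  have hn' : (3 : ℝ) ≤ n := by exact_mod_cast hn
  have h0 : (n : ℝ) ≠ 0 := by linarith
  have h02 : (n : ℝ) - 2 ≠ 0 := by linarith
  have ht := h.trace_gaussTensor hx
  have h1 : trace g (fun a b y => contract1 g S (differential t) a b y + pd a t y * pd b t y) x =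
      inner1 g (differential t) (differential t) x := by
    have h2 := trace_contract1 (h.S_traceFree x hx) (differential t)
    simp only [trace] at h2
    simp only [trace, mul_add, Finset.sum_add_distrib, h2, inner1, differential, mul_assoc,
      zero_add]
  have h2 := trace_trProd (x := x) h.g_symm h.S_symm₂₃
  -- `τ` itself contains `2 P°`, so `P° - τ/8` has `(3/4) P°`. The factor `12` clears `1/8 · 2/3`,
  -- and `n - 2` clears the denominator of the Schouten tensor, producing exactly `9 Ric°` and the
  -- remaining coefficients of `gaussTensor`.
  have hτ (i j : Fin n) : 12 * ((n : ℝ) - 2) *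
      (traceFree g (schouten g) i j x - 1 / 8 * tau g S t i j x) =
      gaussTensor g S t i j x - 1 / (n : ℝ) * trace g (gaussTensor g S t) x * g i j x := by
    rw [tau, h.traceFree_schouten hx hn, traceFree, traceFree, h1, h2, ht, gaussTensor]
    field_simp
    ring
  constructor
  · intro hE
    have ht0 : trace g (gaussTensor g S t) x = 0 := by simp [trace, hE]
    refine ⟨fun i j => ?_, by linarith⟩
    have := hτ i j
    rw [hE, ht0] at this
    simp only [mul_zero, zero_mul, sub_zero, mul_eq_zero, h02, or_false,
      OfNat.ofNat_ne_zero, false_or] at this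
    linarith
  · rintro ⟨hP, hs⟩ i j
    have ht0 : trace g (gaussTensor g S t) x = 0 := by rw [ht, hs]; ring
    have := hτ i j
    rw [hP, ht0] at this
    linarith

/-! ### The shape operator in dimension two -/

/-- In the odd Gauss equation both the shape terms and the Hessian terms are trace-free, hence so is
`div S`; and `S(grad t)` is trace-free because `S` is. -/
theorem trace_chi (h : IsAssociatedOn U g S t f ξ) (hx : x ∈ U) : trace g (chi g S t) x = 0 := by
  have h1 (j k : Fin n) : div3 g S j k x = 3 / 2 * (g j k x * (∑ m, shape f ξ x m m)
      - (n : ℝ) * ∑ m, g m k x * shape f ξ x m j) + (n : ℝ) * hessian (christoffel g) t j k x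
      - trace g (hessian (christoffel g) t) x * g j k x := by
    linarith [h.div3_sub_hessian_eq hx j k]
  have h2 := trace_contract1 (h.S_traceFree x hx) (differential t)
  have h3 := h.trace_metric_eq hx
  have h4 := h.trace_lowered_shape hx (shape f ξ x)
  have h5 : trace g (chi g S t) x = 3 / 2 * ((∑ j, ∑ k, inv g j k x * g j k x) *
      (∑ m, shape f ξ x m m)
      - (n : ℝ) * ∑ j, ∑ k, inv g j k x * ∑ m, g m k x * shape f ξ x m j)
      + (n : ℝ) * trace g (hessian (christoffel g) t) x
      - trace g (hessian (christoffel g) t) x * (∑ j, ∑ k, inv g j k x * g j k x)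
      + 2 / 3 * trace g (contract1 g S (differential t)) x := by
    obtain ⟨L, hL⟩ : ∃ L : Fin n → Fin n → ℝ, ∀ j k, ∑ m, g m k x * shape f ξ x m j = L j k :=
      ⟨_, fun _ _ => rfl⟩
    obtain ⟨B, hB⟩ : ∃ B, trace g (hessian (christoffel g) t) x = B := ⟨_, rfl⟩
    simp only [hL, hB] at h1 ⊢
    nth_rewrite 1 [← hB]
    generalize (∑ m, shape f ξ x m m) = A at h1 ⊢
    simp only [trace, chi, h1]
    simp only [Finset.mul_sum, Finset.sum_mul, ← Finset.sum_sub_distrib, ← Finset.sum_add_distrib]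
    exact Finset.sum_congr rfl fun _ _ => Finset.sum_congr rfl fun _ _ => by ring
  rw [h5, h2, h3, h4]
  ring

/-- The scalar condition says `tr A = 0` (`htr`, from the even equation). The condition on `τ` is
the odd equation rewritten, with the Laplacian of `t` read off from the trace of `τ` (`hlap`). -/
theorem shape_eq_zero_iff_two_dim (h : IsAssociatedOn U g S t f ξ) (hx : x ∈ U) (hn : n = 2)
    (hτ : trace g (tau2D g S t) x = 0) :
    (∀ k i, shape f ξ x k i = 0) ↔
      scal g x = 1 / 9 * (normSq3 g S x - 4 * inner1 g (differential t) (differential t) x) ∧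
      ∀ i j, tau2D g S t i j x = 2 / 3 * chi g S t i j x
        - 8 / 9 * (contract1 g S (differential t) i j x
          + differential t i x * differential t j x
          - 1 / 2 * inner1 g (differential t) (differential t) x * g i j x) := by
  have hn' : (n : ℝ) = 2 := by exact_mod_cast hn
  have hc := trace_contract1 (h.S_traceFree x hx) (differential t)
  have hg := h.trace_metric_eq hx
  have hN : ∑ i, ∑ j, inv g i j x * (pd i t x * pd j t x) =
      inner1 g (differential t) (differential t) x := by
    simp only [inner1, differential, mul_assoc]
  have hlap : trace g (hessian (christoffel g) t) x = 1 / 3 * normSq3 g S x + 3 / 2 * scal g x := by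
    have h1 : trace g (tau2D g S t) x = 2 / 3 * trace g (hessian (christoffel g) t) x
        - 2 / 3 * trace g (contract1 g S (differential t)) x + 1 / 3 * trace g (chi g S t) x
        - 8 / 9 * (∑ i, ∑ j, inv g i j x * (pd i t x * pd j t x)
          - 1 / 2 * inner1 g (differential t) (differential t) x *
            ∑ j, ∑ k, inv g j k x * g j k x)
        - 1 / 9 * normSq3 g S x * (∑ j, ∑ k, inv g j k x * g j k x)
        - 1 / 2 * scal g x * ∑ j, ∑ k, inv g j k x * g j k x := by
      simp only [trace, tau2D, Finset.mul_sum, ← Finset.sum_sub_distrib,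
        ← Finset.sum_add_distrib]
      exact Finset.sum_congr rfl fun _ _ => Finset.sum_congr rfl fun _ _ => by ring
    rw [hτ, hc, h.trace_chi hx, hN, hg, hn'] at h1
    linarith
  have htr : 9 * ∑ m, shape f ξ x m m = 9 * scal g x
      + 4 * inner1 g (differential t) (differential t) x - normSq3 g S x := by
    have h1 := h.trace_gaussTensor hx
    rw [h.trace_gaussTensor_eq hx, hn'] at h1
    linarith
  have hodd := h.div3_sub_hessian_eq hx
  simp only [hn', hlap] at hodd
  rw [h.shape_eq_zero_iff hx]
  simp only [tau2D, chi, differential] at *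
  constructor
  · intro h0
    have htr0 : ∑ m, shape f ξ x m m = 0 := by
      rw [← h.trace_lowered_shape hx]
      simp [h0]
    refine ⟨by linarith, fun i j => ?_⟩
    have := hodd i j
    rw [h0, htr0] at this
    -- The difference of the two sides of the `τ`-equation is `-1/2` times the left side of the odd
    -- equation: the `S(grad t)` and `dt` terms cancel. When `tr A = 0` it therefore equals the
    -- lowered shape operator, which also gives the converse below.
    linear_combination (-1 / 2) * this
  · rintro ⟨hs, hE⟩ i j
    have htr0 : ∑ m, shape f ξ x m m = 0 := by linarith
    have h1 := hodd i j
    rw [htr0] at h1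
    linear_combination (1 / 2) * h1 + hE i j

end IsAssociatedOn

/-! ### Locally constant transversal fields -/

theorem fderiv_eq_zero_of_pd {f : Space n → V} {x : Space n}
    (h : ∀ i, pd i f x = 0) : fderiv ℝ f x = 0 := by
  apply ContinuousLinearMap.coe_injective
  refine (EuclideanSpace.basisFun (Fin n) ℝ).toBasis.ext fun i => ?_
  simpa [pd] using h i

/-- On a ball around `x` the field `ξ` is constant, so `φ = L ∘ f` for a fixed functional `L` with
`L ξ = 1`. Applying `L` to the structure equation removes the tangential terms in favour of
derivatives of `φ`. The inner product is auxiliary, but it yields a formula for `φ` free of local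
choices, hence a global function on `M`. -/
theorem hessian_of_parallel_transversal {V : Type*} [NormedAddCommGroup V] [InnerProductSpace ℝ V]
    {U : Set (Space n)} (hU : IsOpen U)
    {f ξ : Space n → V} (hf : ContDiffOn ℝ ∞ f U) (hξ : ContDiffOn ℝ ∞ ξ U)
    (hpd : ∀ y ∈ U, ∀ i, pd i ξ y = 0) {x : Space n} (hx : x ∈ U) (hξx : ξ x ≠ 0)
    {φ : Space n → ℝ} (hφ : ∀ y ∈ U, φ y = inner ℝ (ξ y) (f y) / inner ℝ (ξ y) (ξ y))
    {Γ : Tensor3 n} {i j : Fin n} {c : ℝ}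
    (hstr : pd i (pd j f) x = ∑ k, Γ k i j x • pd k f x + c • ξ x) :
    hessian Γ φ i j x = c := by
  obtain ⟨r, hr, hB⟩ := Metric.isOpen_iff.1 hU x hx
  have hconst : ∀ y ∈ Metric.ball x r, ξ y = ξ x := fun y hy =>
    Metric.isOpen_ball.is_const_of_fderiv_eq_zero (convex_ball x r).isPreconnected
      (fun z hz => (differentiableAt_of_contDiffOn hU hξ (hB hz)).differentiableWithinAt)
      (fun z hz => fderiv_eq_zero_of_pd (hpd z (hB hz))) hy (Metric.mem_ball_self hr)
  let L : V →L[ℝ] ℝ := (inner ℝ (ξ x) (ξ x))⁻¹ • innerSL ℝ (ξ x)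
  have hL (v : V) : L v = inner ℝ (ξ x) v / inner ℝ (ξ x) (ξ x) := by
    simp [L, div_eq_inv_mul]
  have hLξ : L (ξ x) = 1 := by
    rw [hL]
    exact div_self (inner_self_ne_zero.2 hξx)
  have h1 (k : Fin n) : ∀ y ∈ Metric.ball x r, pd k φ y = L (pd k f y) := fun y hy => by
    rw [pd_congr_of_eqOn Metric.isOpen_ball (h := fun y => L (f y))
      (fun z hz => by rw [hφ z (hB hz), hconst z hz, hL]) hy,
      pd_clm_comp L (differentiableAt_of_contDiffOn hU hf (hB hy))]
  have hx' : x ∈ Metric.ball x r := Metric.mem_ball_self hr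
  rw [hessian, pd_congr_of_eqOn Metric.isOpen_ball (h1 j) hx',
    pd_clm_comp L (differentiableAt_of_contDiffOn hU (contDiffOn_pd hU hf j) hx), hstr]
  simp [h1 _ x hx', hLξ]

end Coord

/-! ### From coordinate domains to the manifold -/

section

open Coord

variable {n : ℕ} {M : Type*} [TopologicalSpace M] [ChartedSpace (EuclideanSpace ℝ (Fin n)) M]

theorem contDiffOn_comp_chart_symm {V : Type*} [NormedAddCommGroup V] [NormedSpace ℝ V] {u : M → V}
    (hu : ContMDiff (𝓡 n) 𝓘(ℝ, V) ∞ u)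
    {e : OpenPartialHomeomorph M (EuclideanSpace ℝ (Fin n))} (he : e ∈ Charts n M) :
    ContDiffOn ℝ ∞ (u ∘ e.symm) e.target :=
  contMDiffOn_iff_contDiffOn.1 (hu.comp_contMDiffOn (contMDiffOn_symm_of_mem_maximalAtlas he))

theorem IsAbundantManifold.two_le {g : TensorField2 n M} {S : TensorField3 n M} {t : M → ℝ}
    (h : IsAbundantManifold g S t) : 2 ≤ n := by
  rcases h with h | h
  · exact le_trans (by norm_num) h.three_le
  · exact h.eq_two.ge

theorem IsAbundantManifold.basic {g : TensorField2 n M} {S : TensorField3 n M} {t : M → ℝ}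
    (h : IsAbundantManifold g S t) : IsPseudoRiemannianMetric g ∧ IsSymmetricTraceFree g S ∧
      ContMDiff (𝓡 n) 𝓘(ℝ, ℝ) ∞ t := by
  rcases h with h | h <;> exact ⟨h.metric, h.symmTraceFree, h.smooth⟩

theorem IsAssociatedNormalisation.isAssociatedOn {g : TensorField2 n M} {S : TensorField3 n M}
    {t : M → ℝ} {f ξ : M → EuclideanSpace ℝ (Fin (n + 1))}
    (hassoc : IsAssociatedNormalisation g S t f ξ) (habundant : IsAbundantManifold g S t)
    {e : OpenPartialHomeomorph M (EuclideanSpace ℝ (Fin n))} (he : e ∈ Charts n M) :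
    IsAssociatedOn e.target (g.inChart e) (S.inChart e) (t ∘ e.symm) (f ∘ e.symm)
      (ξ ∘ e.symm) := by
  obtain ⟨hg, hS, ht⟩ := habundant.basic
  exact
    { isOpen := e.open_target
      smooth_g := hg.smooth e he
      smooth_S := hS.smooth e he
      smooth_t := contDiffOn_comp_chart_symm ht he
      smooth_f := contDiffOn_comp_chart_symm hassoc.smooth_f he
      smooth_ξ := contDiffOn_comp_chart_symm hassoc.smooth_ξ he
      g_symm := fun i j => funext fun x => hg.symm _ _ _
      S_symm₁₂ := fun i j k => funext fun x => hS.symm₁₂ _ _ _ _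
      S_symm₂₃ := fun i j k => funext fun x => hS.symm₂₃ _ _ _ _
      S_traceFree := hS.traceFree e he
      det_ne_zero := fun x hx => by
        have h := hassoc.nondegenerate e he x hx
        simpa only [hassoc.metric_eq e he x hx] using h
      frame_det_ne_zero := fun x hx => adaptedFrame_det_ne_zero
        (lt_of_lt_of_le two_pos habundant.two_le) (hassoc.nondegenerate e he x hx)
      relative := hassoc.relative e he
      metric_eq := hassoc.metric_eq e he
      cubic_eq := hassoc.cubic_eq e he }

/-- A normalisation associated to an abundant manifold is an affine graph normalisation if and only
if its transversal field is locally constant. -/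
theorem IsAssociatedNormalisation.isAffineGraphNormalisation_iff {g : TensorField2 n M}
    {S : TensorField3 n M} {t : M → ℝ} {f ξ : M → EuclideanSpace ℝ (Fin (n + 1))}
    (hassoc : IsAssociatedNormalisation g S t f ξ) (habundant : IsAbundantManifold g S t) :
    IsAffineGraphNormalisation f ξ ↔
      InEveryChart (n := n) (M := M) fun e x => ∀ i, pd i (ξ ∘ e.symm) x = 0 := by
  constructor
  · rintro ⟨A, -, F, -, hF⟩ e he x hx i
    have h1 := (hF e he x hx).2 i
    have h2 := pd_clm_comp A.linear.toContinuousLinearEquiv.toContinuousLinearMap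
      (differentiableAt_of_contDiffOn e.open_target
        (contDiffOn_comp_chart_symm hassoc.smooth_ξ he) hx) i
    exact A.linear.map_eq_zero_iff.1 (h2.symm.trans h1)
  · intro h0
    -- Transversality tested on the zero tangent vector.
    have hξ (p : M) : ξ p ≠ 0 := fun h =>
      hassoc.transversal p 0 (by rw [h]; exact map_zero _)
    -- No affine change is needed: the defining formula for the potential works for any nonvanishing
    -- locally constant `ξ`, even if its value differs between components of `M`.
    refine ⟨AffineEquiv.refl ℝ _, ?_⟩
    change IsGraphNormalisation f ξ
    refine ⟨hassoc.toIsRelativeNormalisation,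
      fun p => inner ℝ (ξ p) (f p) / inner ℝ (ξ p) (ξ p), ?_, fun e he x hx =>
        ⟨fun i j => ?_, h0 e he x hx⟩⟩
    · exact (contDiff_inner.contMDiff.comp (hassoc.smooth_ξ.prodMk_space hassoc.smooth_f)).div₀
        (contDiff_inner.contMDiff.comp (hassoc.smooth_ξ.prodMk_space hassoc.smooth_ξ))
        fun p => inner_self_ne_zero.2 (hξ p)
    · have h := hassoc.isAssociatedOn habundant he
      have hstr := h.structure_eq hx i j
      rw [hessian_of_parallel_transversal h.isOpen h.smooth_f h.smooth_ξ (h0 e he) hx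
        (hξ (e.symm x))
        (φ := (fun p => inner ℝ (ξ p) (f p) / inner ℝ (ξ p) (ξ p)) ∘ e.symm) (fun y _ => rfl) hstr]
      exact hstr

end

theorem mainTheorem5 {n : ℕ} {M : Type*} [TopologicalSpace M]
    [ChartedSpace (EuclideanSpace ℝ (Fin n)) M] [IsManifold (𝓡 n) ∞ M]
    (g : TensorField2 n M) (S : TensorField3 n M) (t : M → ℝ)
    (habundant : IsAbundantManifold g S t)
    (f ξ : M → EuclideanSpace ℝ (Fin (n + 1)))
    (hassociated : IsAssociatedNormalisation g S t f ξ) :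
    IsAffineGraphNormalisation f ξ ↔
      (3 ≤ n → InEveryChart (n := n) (M := M) fun e x =>
        (∀ i j, Coord.traceFree (g.inChart e) (Coord.schouten (g.inChart e)) i j x =
          1 / 8 * Coord.tau (g.inChart e) (S.inChart e) (t ∘ e.symm) i j x) ∧
        Coord.scal (g.inChart e) x =
          1 / 9 * (Coord.normSq3 (g.inChart e) (S.inChart e) x
            - ((n : ℝ) - 1) * ((n : ℝ) + 2) *
              Coord.inner1 (g.inChart e) (Coord.differential (t ∘ e.symm))
                (Coord.differential (t ∘ e.symm)) x)) ∧
      (n = 2 → InEveryChart (n := n) (M := M) fun e x =>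
        Coord.scal (g.inChart e) x =
          1 / 9 * (Coord.normSq3 (g.inChart e) (S.inChart e) x
            - 4 * Coord.inner1 (g.inChart e) (Coord.differential (t ∘ e.symm))
                (Coord.differential (t ∘ e.symm)) x) ∧
        (∀ i j, Coord.tau2D (g.inChart e) (S.inChart e) (t ∘ e.symm) i j x =
          2 / 3 * Coord.chi (g.inChart e) (S.inChart e) (t ∘ e.symm) i j x
            - 8 / 9 * (Coord.contract1 (g.inChart e) (S.inChart e)
                  (Coord.differential (t ∘ e.symm)) i j x
                + Coord.differential (t ∘ e.symm) i x * Coord.differential (t ∘ e.symm) j x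
                - 1 / 2 * Coord.inner1 (g.inChart e) (Coord.differential (t ∘ e.symm))
                    (Coord.differential (t ∘ e.symm)) x * g.inChart e i j x))) := by
  have hchart : IsAffineGraphNormalisation f ξ ↔ InEveryChart (n := n) (M := M) fun e x =>
      ∀ k i, Coord.shape (f ∘ e.symm) (ξ ∘ e.symm) x k i = 0 := by
    rw [hassociated.isAffineGraphNormalisation_iff habundant]
    exact forall₄_congr fun e he x hx =>
      (hassociated.isAssociatedOn habundant he).pd_eq_zero_iff hx
  rw [hchart]
  rcases habundant.two_le.eq_or_lt with hn | hn
  · have h2 : IsAbundant2D g S t := habundant.resolve_left fun h => by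
      have := h.three_le
      omega
    have key := forall₄_congr fun e (he : e ∈ Charts n M) x (hx : x ∈ e.target) =>
      (hassociated.isAssociatedOn habundant he).shape_eq_zero_iff_two_dim hx hn.symm
        (h2.tau_traceFree e he x hx)
    exact key.trans ⟨fun h => ⟨fun h3 => absurd h3 (by omega), fun _ => h⟩,
      fun h => h.2 hn.symm⟩
  · have key := forall₄_congr fun e (he : e ∈ Charts n M) x (hx : x ∈ e.target) =>
      ((hassociated.isAssociatedOn habundant he).shape_eq_zero_iff_gaussTensor hx hn).trans
        ((hassociated.isAssociatedOn habundant he).gaussTensor_eq_zero_iff hx hn)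
    exact key.trans ⟨fun h => ⟨fun _ => h, fun h3 => absurd h3 (by omega)⟩, fun h => h.1 hn⟩
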